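/- Let $G_B=([m],[n],E)$ be a finite bipartite graph with left vertices $[m]$ and right vertices $[n]$, and write $\mathcal N(i)\subseteq[n]$ for the neighbours of a left vertex $i$. Its dependency graph $G_D=G_D(G_B)$ has vertex set $[m]$, with $i\ne i'$ adjacent iff $\mathcal N(i)\cap\mathcal N(i')\neq\emptyset$. For a finite graph $H$ and a vector $\mathbf x$ indexed by its vertices let $I(H,\mathbf x)=\sum_{S}(-1)^{|S|}\prod_{v\in S}x_v$, the sum over all independent sets $S$ of $H$. A vector $\mathbf r\in(0,1]^m$ is beyond Shearer's bound if $I(G_D[S],\mathbf r|_S)\le 0$ for some $S\subseteq[m]$, where $G_D[S]$ is the induced subgraph. For $\mathbf d\in\mathbb Z_{>0}^n$ let $\mathcal H_j=\mathbb C^{d_j}$, $\mathcal H_S=\bigotimes_{j\in S}\mathcal H_j$ for $S\subseteq[n]$, and let $R(W)=\dim W/\dim \mathcal H$ denote the relative dimension of a subspace $W$ of a space $\mathcal H$. For a rational vector $\mathbf r$, we say that almost all $\mathcal V=(V_1,\dots,V_m)$ of the setting $(G_B,\mathbf r,\mathbf d)$ have a property if it holds with probability $1$ when $V_i=V_i^{loc}\otimes\mathcal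 H_{[n]\setminus\mathcal N(i)}$, where $V_1^{loc},\dots,V_m^{loc}$ are independent and $V_i^{loc}$ is a Haar-random subspace of $\mathcal H_{\mathcal N(i)}$ of relative dimension $r_i$. (If for some $i$ no subspace of $\mathcal H_{\mathcal N(i)}$ has relative dimension $r_i$, there are no such $\mathcal V$ and the assertion is vacuous.) **Theorem.** For every bipartite graph $G_B=([m],[n],E)$ and every real $\varepsilon>0$ there is $\mathbf D=(D_1,\dots,D_n)\in\mathbb Z_{\ge0}^n$ with $$D_j\le\left\lceil \frac{2\,\lceil 2m/\varepsilon\rceil^{\,m2^{2m}}\,mn}{\varepsilon}\right\rceil\qquad\text{for all } j\in[n],$$ such that for every $\mathbf d\in\mathbb Z_{>0}^n$ with $\mathbf d\ge\mathbf D$ and every rational $\mathbf r\in(0,1]^m$ the following holds. (a) If $\mathbf r$ is beyond Shearer's bound, then for every rational $\mathbf r'$ with $r'_i\ge r_i+\varepsilon/m$ for all $i$, almost all $\mathcal V'$ of the setting $(G_B,\mathbf r',\mathbf d)$ satisfy $R\big(\sum_{i=1}^m V'_i\big)=1$; and almost all $\mathcal V$ of the setting $(G_B,\mathbf r,\mathbf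 d)$ satisfy $R\big(\sum_{i=1}^m V_i\big)\in[1-\varepsilon,1]$. (b) Otherwise, for every rational $\mathbf r'$ with $r'_i\ge r_i+\varepsilon/m$ for all $i$, almost all $\mathcal V'$ of the setting $(G_B,\mathbf r',\mathbf d)$ satisfy $R\big(\sum_{i=1}^m V'_i\big)\ge 1-I(G_D,\mathbf r)$; and almost all $\mathcal V$ of the setting $(G_B,\mathbf r,\mathbf d)$ satisfy $R\big(\sum_{i=1}^m V_i\big)\in[1-I(G_D,\mathbf r)-\varepsilon,\ 1-I(G_D,\mathbf r)]$. -/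

import Mathlib

open MeasureTheory

namespace QLLL

/-! ### Bipartite graphs, dependency graphs, the independence polynomial -/

/-- The set `N(i)` of right vertices adjacent to the left vertex `i` in the bipartite graph
`([m], [n], E)`; a bipartite graph is given by its edge set `E ⊆ [m] × [n]`. -/
def nbr {m n : ℕ} (E : Finset (Fin m × Fin n)) (i : Fin m) : Finset (Fin n) :=
  Finset.univ.filter fun j => (i, j) ∈ E

/-- The dependency graph of a bipartite graph: distinct left vertices are adjacent iff they have
a common right neighbour. -/
def depGraph {m n : ℕ} (E : Finset (Fin m × Fin n)) : SimpleGraph (Fin m) where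
  Adj i i' := i ≠ i' ∧ (nbr E i ∩ nbr E i').Nonempty
  symm := ⟨fun i i' h => ⟨h.1.symm, by rw [Finset.inter_comm]; exact h.2⟩⟩
  loopless := ⟨fun _ h => h.1 rfl⟩

open Classical in
/-- The multivariate independence polynomial
`I(H, x) = ∑_{S independent in H} (-1)^|S| ∏_{v ∈ S} x_v`. -/
noncomputable def indepPoly {V : Type*} [Fintype V] (H : SimpleGraph V) (x : V → ℚ) : ℚ :=
  ∑ S ∈ (Finset.univ : Finset (Finset V)).filter (fun S : Finset V => H.IsIndepSet (S : Set V)),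
    (-1) ^ S.card * ∏ v ∈ S, x v

/-- `x` is beyond Shearer's bound for `H`: some induced subgraph has nonpositive independence
polynomial. Otherwise `x` is in Shearer's bound. -/
def BeyondShearer {V : Type*} (H : SimpleGraph V) (x : V → ℚ) : Prop :=
  ∃ S : Finset V, indepPoly (H.induce (S : Set V)) (fun v => x v) ≤ 0

/-! ### Qudits -/

/-- Labels of the computational basis of a system of qudits indexed by `ι` with dimensions `d`. -/
abbrev Config {ι : Type*} (d : ι → ℕ) : Type _ := (j : ι) → Fin (d j)

/-- The space `⨂_{j ∈ ι} ℂ^{d j}`, written in coordinates with respect to the (orthonormal)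
computational basis of product vectors. -/
abbrev QuditSpace {ι : Type*} (d : ι → ℕ) : Type _ := Config d → ℂ

/-- The dimensions of the qudits in `S`. -/
abbrev restrictDims {n : ℕ} (d : Fin n → ℕ) (S : Finset (Fin n)) : {j : Fin n // j ∈ S} → ℕ :=
  fun j => d j

/-- The restriction of a basis label to the qudits in `S`. -/
abbrev restrictConfig {n : ℕ} {d : Fin n → ℕ} (S : Finset (Fin n)) (x : Config d) :
    Config (restrictDims d S) :=
  fun j => x j

/-- For a subspace `W` of the space of the qudits in `S`, the subspace `W ⊗ H_{[n] \ S}` of the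
space of all qudits: it is spanned by the product vectors `φ ⊗ χ` with `φ ∈ W` and `χ` a vector of
the qudits outside `S`. -/
def extend {n : ℕ} {d : Fin n → ℕ} (S : Finset (Fin n))
    (W : Submodule ℂ (QuditSpace (restrictDims d S))) : Submodule ℂ (QuditSpace d) :=
  Submodule.span ℂ {ψ | ∃ φ ∈ W, ∃ χ : QuditSpace (restrictDims d Sᶜ),
    ψ = fun x => φ (restrictConfig S x) * χ (restrictConfig Sᶜ x)}

/-- The relative dimension `dim W / dim H` of a subspace `W` of `H`. -/
noncomputable def relDim {H : Type*} [AddCommGroup H] [Module ℂ H] (W : Submodule ℂ H) : ℚ :=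
  (Module.finrank ℂ W : ℚ) / (Module.finrank ℂ H : ℚ)

/-! ### Haar measure on the unitary group and random subspaces -/

section Haar

variable (ι : Type*) [Fintype ι] [DecidableEq ι]

noncomputable instance instMeasurableSpaceUnitaryGroup :
    MeasurableSpace (Matrix.unitaryGroup ι ℂ) := borel _

instance instBorelSpaceUnitaryGroup : BorelSpace (Matrix.unitaryGroup ι ℂ) := ⟨rfl⟩

instance instCompactSpaceUnitaryGroup : CompactSpace (Matrix.unitaryGroup ι ℂ) := by
  have hK : IsCompact (Set.univ.pi fun _ : ι => Set.univ.pi fun _ : ι =>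
      Metric.closedBall (0 : ℂ) 1) :=
    isCompact_univ_pi fun _ => isCompact_univ_pi fun _ => isCompact_closedBall 0 1
  have hc : IsClosed ((Matrix.unitaryGroup ι ℂ : Set (Matrix ι ι ℂ))) := isClosed_unitary
  refine isCompact_iff_compactSpace.mp (IsCompact.of_isClosed_subset hK hc ?_)
  intro U hU i _ j _
  simpa using entry_norm_bound_of_unitary hU i j

/-- The Haar probability measure on the group of unitary matrices. -/
noncomputable def haarUnitary : Measure (Matrix.unitaryGroup ι ℂ) :=
  Measure.haarMeasure ⊤

instance instIsProbabilityMeasureHaarUnitary : IsProbabilityMeasure (haarUnitary ι) :=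
  ⟨Measure.haarMeasure_self⟩

end Haar

/-- The image `U W` of a subspace `W` of `ℂ^ι` under a unitary matrix `U`. -/
noncomputable def rotate {ι : Type*} [Fintype ι] [DecidableEq ι] (U : Matrix.unitaryGroup ι ℂ)
    (W : Submodule ℂ (ι → ℂ)) : Submodule ℂ (ι → ℂ) :=
  W.map (Matrix.mulVecLin (U : Matrix ι ι ℂ))

/-- Almost all subspace sets `V₁, …, V_m` of the setting `(E, r, d)` satisfy `P`, that is, `P` holds
with probability one if `V_i = V_i^loc ⊗ H_{[n] \ N(i)}` with independent Haar-random subspaces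
`V_i^loc` of `H_{N(i)}` of relative dimensions `r_i`. A Haar-random subspace of a given dimension
is `U W` with `U` a Haar-random unitary and `W` any fixed subspace of that dimension. -/
def AlmostAll {m n : ℕ} (E : Finset (Fin m × Fin n)) (r : Fin m → ℚ) (d : Fin n → ℕ)
    (P : (Fin m → Submodule ℂ (QuditSpace d)) → Prop) : Prop :=
  ∀ W : (i : Fin m) → Submodule ℂ (QuditSpace (restrictDims d (nbr E i))),
    (∀ i, relDim (W i) = r i) →
      ∀ᵐ U ∂(Measure.pi fun i : Fin m => haarUnitary (Config (restrictDims d (nbr E i)))),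
        P fun i => extend (nbr E i) (rotate (U i) (W i))

end QLLL

/-! Upper bound: `V_v` acts on other qudits than the subspaces of the vertices not adjacent to `v`,
so it meets their sum in at least the product of the relative dimensions (`relDim_sub_inf_le`).
Hence the relative codimension of the sum over a vertex set satisfies, as an inequality, the
recursion `I(S ∪ v) = I(S) - x_v I(S \ N(v))` of the independence polynomial, and `indepSum_mul_le`
turns this into codimension at least `I`. This holds for all subspaces in Shearer's bound, not only
for almost all.

Lower bound: a sum of Haar-random subspaces almost surely has at least the dimension reached by any
single example with at most these dimensions (`ae_finrank_iSup_extend_le`). So one good example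
suffices, and two examples can be realised by subspaces that agree where their dimensions do
(`exists_common_subspaces`).

The examples come from `exists_isFilled`: if the vertices of `S` have dimensions `r`, then a
subspace at `v` of relative dimension `I(S) / I(S \ N(v))` can complete the sum to the whole space.
For a neighbour `i ∈ S` of `v`, one interpolates between a filling completed at `v` and one
completed at `i`, controlled by an extra digit of a qudit seen by both `i` and `v`. Beyond Shearer's
bound this fills the space outright (`exists_iSup_eq_top`); inside it, shrinking the subspace at `v`
back to `r_v` loses at most `I(S)` (`exists_relDim_iSup_ge`).

The interpolation needs dimensions divisible by suitable integers. So `r` is first rounded up to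
multiples of `1/q`, which costs `ε/(2m)`; passing from the special dimensions to arbitrary large
ones costs another `ε/(2m)` (`exists_subspaces_of_le`). The resulting excess `ε/m` per vertex is
either granted by `r'` or cut off again, at a total loss of at most `ε`. -/

namespace QLLL

/-! ### Spaces of functions defined by conditions on slices -/

section Blow

variable {A K B : Type*} [Fintype A] [Fintype K] [Fintype B]

/-- The functions on `B` all of whose slices along `ι`, with second argument `k`, lie in `W k`. -/
def sliceSpace (ι : A → K → B) (W : K → Submodule ℂ (A → ℂ)) : Submodule ℂ (B → ℂ) :=
  ⨅ k, (W k).comap (LinearMap.funLeft ℂ ℂ fun a => ι a k)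

theorem mem_sliceSpace {A K B : Type*} {ι : A → K → B} {W : K → Submodule ℂ (A → ℂ)} {ψ : B → ℂ} :
    ψ ∈ sliceSpace ι W ↔ ∀ k, (fun a => ψ (ι a k)) ∈ W k := by
  simp only [sliceSpace, Submodule.mem_iInf, Submodule.mem_comap]
  rfl

/-- Injectivity makes the slices disjoint, so the conditions are independent and codimensions add
up. Points of `B` outside all slices are unconstrained; this is what later makes leftover labels
harmless. -/
theorem finrank_sliceSpace {ι : A → K → B} (hι : Function.Injective fun p : A × K => ι p.1 p.2)
    (W : K → Submodule ℂ (A → ℂ)) :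
    (Module.finrank ℂ (sliceSpace ι W) : ℚ) + ∑ k, ((Fintype.card A : ℚ) - Module.finrank ℂ (W k)) =
      Fintype.card B := by
  classical
  let Φ : (B → ℂ) →ₗ[ℂ] ((k : K) → (A → ℂ) ⧸ W k) :=
    LinearMap.pi fun k => (W k).mkQ ∘ₗ LinearMap.funLeft ℂ ℂ fun a => ι a k
  have hker : LinearMap.ker Φ = sliceSpace ι W := by
    rw [LinearMap.ker_pi, sliceSpace]
    congr 1
    ext k
    simp [LinearMap.mem_ker]
  have hsurj : Function.Surjective Φ := by
    intro q
    choose f hf using fun k => Submodule.mkQ_surjective (W k) (q k)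
    -- The slices being disjoint, representatives can be prescribed on them separately and extended
    -- by zero.
    refine ⟨Function.extend (fun p : A × K => ι p.1 p.2) (fun p => f p.2 p.1) 0, ?_⟩
    ext k
    have : (LinearMap.funLeft ℂ ℂ fun a => ι a k)
        (Function.extend (fun p : A × K => ι p.1 p.2) (fun p => f p.2 p.1) 0) = f k := by
      ext a
      exact hι.extend_apply (fun p : A × K => f p.2 p.1) 0 (a, k)
    simp only [Φ, LinearMap.pi_apply, LinearMap.comp_apply, this, hf]
  have h := LinearMap.finrank_range_add_finrank_ker Φ
  rw [LinearMap.range_eq_top.2 hsurj, finrank_top, hker, Module.finrank_pi_fintype,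
    Module.finrank_fintype_fun_eq_card] at h
  rw [← h]
  push_cast
  rw [add_comm]
  congr 1
  refine Finset.sum_congr rfl fun k _ => ?_
  have := Submodule.finrank_quotient_add_finrank (W k)
  rw [Module.finrank_fintype_fun_eq_card] at this
  rw [← this]
  push_cast
  ring

end Blow

/-! ### Subspaces acting on some of the qudits, and their intersections -/

section Extend

variable {n : ℕ} {d : Fin n → ℕ}

/-- Glue a label of the qudits in `S` and a label of the qudits outside `S`. -/
def glue (S : Finset (Fin n)) (x : Config (restrictDims d S)) (y : Config (restrictDims d Sᶜ)) :
    Config d :=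
  fun j => if h : j ∈ S then x ⟨j, h⟩ else y ⟨j, Finset.mem_compl.2 h⟩

@[simp] theorem restrict_glue (S : Finset (Fin n)) (x : Config (restrictDims d S))
    (y : Config (restrictDims d Sᶜ)) : restrictConfig S (glue S x y) = x := by
  ext ⟨j, hj⟩
  simp [restrictConfig, glue, hj]

@[simp] theorem restrict_compl_glue (S : Finset (Fin n)) (x : Config (restrictDims d S))
    (y : Config (restrictDims d Sᶜ)) : restrictConfig Sᶜ (glue S x y) = y := by
  ext ⟨j, hj⟩
  have : j ∉ S := Finset.mem_compl.1 hj
  simp [restrictConfig, glue, this]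

@[simp] theorem glue_restrict (S : Finset (Fin n)) (x : Config d) :
    glue S (restrictConfig S x) (restrictConfig Sᶜ x) = x := by
  ext j
  by_cases h : j ∈ S <;> simp [restrictConfig, glue, h]

theorem glue_injective (S : Finset (Fin n)) : Function.Injective
    fun p : Config (restrictDims d S) × Config (restrictDims d Sᶜ) => glue S p.1 p.2 := by
  intro p q h
  refine Prod.ext ?_ ?_
  · simpa using congrArg (restrictConfig S) h
  · simpa using congrArg (restrictConfig Sᶜ) h

/-- Fixing the labels outside `S` turns the span of product vectors into a slice condition;
conversely, a vector is the sum of its slices tensored with basis vectors. -/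
theorem mem_extend {S : Finset (Fin n)} {W : Submodule ℂ (QuditSpace (restrictDims d S))}
    {ψ : QuditSpace d} : ψ ∈ extend S W ↔ ∀ y, (fun x => ψ (glue S x y)) ∈ W := by
  classical
  constructor
  · intro h
    induction h using Submodule.span_induction with
    | mem ψ hψ =>
      obtain ⟨φ, hφ, χ, rfl⟩ := hψ
      intro y
      simp only [restrict_glue, restrict_compl_glue]
      have := W.smul_mem (χ y) hφ
      convert this using 1
      ext x
      simp [mul_comm]
    | zero => intro y; exact W.zero_mem
    | add a b _ _ ha hb => intro y; exact W.add_mem (ha y) (hb y)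
    | smul c a _ ha => intro y; exact W.smul_mem c (ha y)
  · intro h
    have : ψ = ∑ y : Config (restrictDims d Sᶜ), fun x =>
        ψ (glue S (restrictConfig S x) y) * (Pi.single y (1 : ℂ) : QuditSpace (restrictDims d Sᶜ))
          (restrictConfig Sᶜ x) := by
      ext x
      rw [Finset.sum_apply, Finset.sum_eq_single (restrictConfig Sᶜ x)]
      · simp
      · intro y _ hy
        simp [Pi.single_eq_of_ne hy.symm]
      · simp
    rw [this]
    exact Submodule.sum_mem _ fun y _ => Submodule.subset_span
      ⟨fun x => ψ (glue S x y), h y, Pi.single y 1, rfl⟩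

theorem extend_eq_sliceSpace (S : Finset (Fin n))
    (W : Submodule ℂ (QuditSpace (restrictDims d S))) :
    extend S W = sliceSpace (glue S) fun _ => W := by
  ext ψ
  rw [mem_extend, mem_sliceSpace]

theorem prod_mem_extend {S : Finset (Fin n)} {W : Submodule ℂ (QuditSpace (restrictDims d S))}
    {φ : QuditSpace (restrictDims d S)} (hφ : φ ∈ W) (χ : QuditSpace (restrictDims d Sᶜ)) :
    (fun x => φ (restrictConfig S x) * χ (restrictConfig Sᶜ x)) ∈ extend S W :=
  Submodule.subset_span ⟨φ, hφ, χ, rfl⟩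

theorem extend_mono {S : Finset (Fin n)} {W W' : Submodule ℂ (QuditSpace (restrictDims d S))}
    (h : W ≤ W') : extend S W ≤ extend S W' := fun _ hψ =>
  mem_extend.2 fun y => h (mem_extend.1 hψ y)

@[simp] theorem extend_top (S : Finset (Fin n)) :
    extend (d := d) S ⊤ = ⊤ := by
  ext ψ; simp [mem_extend]

@[simp] theorem extend_bot (S : Finset (Fin n)) :
    extend (d := d) S ⊥ = ⊥ := by
  ext ψ
  simp only [mem_extend, Submodule.mem_bot]
  constructor
  · intro h
    ext x
    have := congrFun (h (restrictConfig Sᶜ x)) (restrictConfig S x)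
    simpa using this
  · rintro rfl y
    rfl

theorem extend_sup (S : Finset (Fin n)) (W W' : Submodule ℂ (QuditSpace (restrictDims d S))) :
    extend S (W ⊔ W') = extend S W ⊔ extend S W' := by
  apply le_antisymm
  · refine Submodule.span_le.2 ?_
    rintro _ ⟨φ, hφ, χ, rfl⟩
    obtain ⟨a, ha, b, hb, rfl⟩ := Submodule.mem_sup.1 hφ
    refine Submodule.mem_sup.2 ⟨_, prod_mem_extend ha χ, _, prod_mem_extend hb χ, ?_⟩
    ext x
    simp [add_mul]
  · exact sup_le (extend_mono le_sup_left) (extend_mono le_sup_right)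

theorem card_config {ι : Type*} [Fintype ι] [DecidableEq ι] (d : ι → ℕ) :
    Fintype.card (Config d) = ∏ j, d j := by
  simp [Config, Fintype.card_pi]

theorem card_config_restrict (d : Fin n → ℕ) (S : Finset (Fin n)) :
    Fintype.card (Config (restrictDims d S)) = ∏ j ∈ S, d j := by
  rw [card_config, ← Finset.prod_coe_sort S d]

theorem card_config_mul_compl (d : Fin n → ℕ) (S : Finset (Fin n)) :
    Fintype.card (Config (restrictDims d S)) * Fintype.card (Config (restrictDims d Sᶜ)) =
      Fintype.card (Config d) := by
  rw [card_config_restrict, card_config_restrict, card_config, Finset.prod_mul_prod_compl]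

theorem finrank_extend (S : Finset (Fin n)) (W : Submodule ℂ (QuditSpace (restrictDims d S))) :
    Module.finrank ℂ (extend S W) = Module.finrank ℂ W * ∏ j ∈ Sᶜ, d j := by
  have h := finrank_sliceSpace (glue_injective (d := d) S) fun _ => W
  rw [← extend_eq_sliceSpace, Finset.sum_const, Finset.card_univ,
    ← card_config_mul_compl d S, card_config_restrict d Sᶜ] at h
  have : (Module.finrank ℂ (extend S W) : ℚ) = Module.finrank ℂ W * ∏ j ∈ Sᶜ, d j := by
    simp only [nsmul_eq_mul] at h
    push_cast at h ⊢
    linarith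
  exact_mod_cast this

theorem relDim_eq {A : Type*} [Fintype A] (W : Submodule ℂ (A → ℂ)) :
    relDim W = (Module.finrank ℂ W : ℚ) / Fintype.card A := by
  rw [relDim, Module.finrank_fintype_fun_eq_card]

theorem relDim_le_one {A : Type*} [Fintype A] (W : Submodule ℂ (A → ℂ)) : relDim W ≤ 1 := by
  rw [relDim]
  apply div_le_one_of_le₀ _ (Nat.cast_nonneg _)
  exact_mod_cast Submodule.finrank_le W

theorem relDim_nonneg {A : Type*} [Fintype A] (W : Submodule ℂ (A → ℂ)) : 0 ≤ relDim W := by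
  rw [relDim]; positivity

theorem relDim_mono {A : Type*} [Fintype A] {W W' : Submodule ℂ (A → ℂ)} (h : W ≤ W') :
    relDim W ≤ relDim W' := by
  rw [relDim, relDim]
  have := Submodule.finrank_mono h
  gcongr

theorem relDim_bot {A : Type*} [Fintype A] : relDim (⊥ : Submodule ℂ (A → ℂ)) = 0 := by
  simp [relDim]

theorem relDim_top {A : Type*} [Fintype A] [Nonempty A] :
    relDim (⊤ : Submodule ℂ (A → ℂ)) = 1 := by
  rw [relDim, finrank_top]
  apply div_self
  rw [Module.finrank_fintype_fun_eq_card]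
  exact_mod_cast Fintype.card_ne_zero

theorem relDim_extend (hd : ∀ j, 0 < d j) (S : Finset (Fin n))
    (W : Submodule ℂ (QuditSpace (restrictDims d S))) : relDim (extend S W) = relDim W := by
  rw [relDim_eq, relDim_eq, finrank_extend, ← card_config_mul_compl d S, card_config_restrict d Sᶜ]
  have : (0 : ℚ) < ((∏ j ∈ Sᶜ, d j : ℕ) : ℚ) := by
    exact_mod_cast Finset.prod_pos fun j _ => hd j
  push_cast at this ⊢
  rw [mul_div_mul_right _ _ this.ne']

/-- The intersection contains `W ⊗ Y`: a basis of `W` with coefficients in `Y` embeds `Y ^ dim W`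
into it. -/
theorem finrank_mul_le_finrank_inf (S : Finset (Fin n))
    (W : Submodule ℂ (QuditSpace (restrictDims d S)))
    (Y : Submodule ℂ (QuditSpace (restrictDims d Sᶜ))) :
    Module.finrank ℂ W * Module.finrank ℂ Y ≤
      Module.finrank ℂ (extend S W ⊓ sliceSpace (fun y x => glue S x y) fun _ => Y :
        Submodule ℂ (QuditSpace d)) := by
  let b := Module.finBasis ℂ W
  let T : (Fin (Module.finrank ℂ W) → Y) →ₗ[ℂ] QuditSpace d :=
    { toFun := fun η x => ∑ i, (b i : QuditSpace (restrictDims d S)) (restrictConfig S x) *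
        (η i : QuditSpace (restrictDims d Sᶜ)) (restrictConfig Sᶜ x)
      map_add' := fun η η' => by
        ext x; simp [mul_add, Finset.sum_add_distrib]
      map_smul' := fun c η => by
        ext x
        simp only [Pi.smul_apply, Submodule.coe_smul, smul_eq_mul, RingHom.id_apply, Finset.mul_sum]
        exact Finset.sum_congr rfl fun i _ => by ring }
  have hmem : ∀ η, T η ∈ (extend S W ⊓ sliceSpace (fun y x => glue S x y) fun _ => Y :
      Submodule ℂ (QuditSpace d)) := by
    intro η
    refine ⟨mem_extend.2 fun y => ?_, mem_sliceSpace.2 fun x => ?_⟩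
    · have : (fun x => T η (glue S x y)) = ∑ i, (η i : QuditSpace (restrictDims d Sᶜ)) y •
          (b i : QuditSpace (restrictDims d S)) := by
        ext x
        simp [T, mul_comm]
      rw [this]
      exact Submodule.sum_mem _ fun i _ => W.smul_mem _ (b i).2
    · have : (fun y => T η (glue S x y)) = ∑ i, (b i : QuditSpace (restrictDims d S)) x •
          (η i : QuditSpace (restrictDims d Sᶜ)) := by
        ext y
        simp [T]
      rw [this]
      exact Submodule.sum_mem _ fun i _ => Y.smul_mem _ (η i).2
  have hinj : Function.Injective (T.codRestrict _ hmem) := by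
    rw [← LinearMap.ker_eq_bot, LinearMap.ker_codRestrict, LinearMap.ker_eq_bot']
    intro η hη
    have key : ∀ y, ∑ i, (η i : QuditSpace (restrictDims d Sᶜ)) y • b i = 0 := by
      intro y
      apply Subtype.ext
      ext x
      have := congrFun hη (glue S x y)
      simpa [T, mul_comm] using this
    ext i y
    exact Fintype.linearIndependent_iff.1 b.linearIndependent _ (key y) i
  have := LinearMap.finrank_le_finrank_of_injective hinj
  rwa [Module.finrank_pi_fintype, Finset.sum_const, Finset.card_univ, Fintype.card_fin,
    smul_eq_mul] at this

/-- Tensoring with the full space of the qudits in `S` commutes with sums. -/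
theorem sliceSpace_iSup {ι : Type*} (S : Finset (Fin n))
    (Y : ι → Submodule ℂ (QuditSpace (restrictDims d Sᶜ))) :
    (sliceSpace (fun y x => glue S x y) fun _ => ⨆ i, Y i) =
      ⨆ i, sliceSpace (fun y x => glue S x y) fun _ => Y i := by
  classical
  apply le_antisymm
  · intro ψ hψ
    rw [mem_sliceSpace] at hψ
    let T (x : Config (restrictDims d S)) : QuditSpace (restrictDims d Sᶜ) →ₗ[ℂ] QuditSpace d :=
      { toFun := fun η z => (Pi.single x (1 : ℂ) : QuditSpace (restrictDims d S))
          (restrictConfig S z) * η (restrictConfig Sᶜ z)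
        map_add' := fun η η' => by ext z; simp [mul_add]
        map_smul' := fun c η => by ext z; simp; ring }
    have hT : ∀ x i, (Y i).map (T x) ≤ sliceSpace (fun y x => glue S x y) fun _ => Y i := by
      rintro x i _ ⟨η, hη, rfl⟩
      rw [mem_sliceSpace]
      intro x'
      convert (Y i).smul_mem ((Pi.single x (1 : ℂ) : QuditSpace (restrictDims d S)) x') hη using 1
      ext y
      simp [T]
    have : ψ = ∑ x, T x fun y => ψ (glue S x y) := by
      ext z
      rw [Finset.sum_apply, Finset.sum_eq_single (restrictConfig S z)]
      · simp [T]
      · intro x _ hx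
        simp [T, Pi.single_eq_of_ne hx.symm]
      · simp
    rw [this]
    refine Submodule.sum_mem _ fun x _ => ?_
    have h1 := Submodule.mem_map_of_mem (f := T x) (hψ x)
    rw [Submodule.map_iSup] at h1
    exact iSup_mono (hT x) h1
  · refine iSup_le fun i ψ hψ => ?_
    rw [mem_sliceSpace] at hψ ⊢
    exact fun x => Submodule.mem_iSup_of_mem i (hψ x)

/-- A subspace acting on qudits outside `S` is the full space of the qudits in `S` tensored with a
subspace for `Sᶜ`. Together with `sliceSpace_iSup`, a sum of such subspaces has the same form. -/
theorem extend_eq_sliceSpace_of_disjoint {S N : Finset (Fin n)} (hN : Disjoint N S)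
    (W : Submodule ℂ (QuditSpace (restrictDims d N))) :
    extend N W = sliceSpace (fun y x => glue S x y) fun _ =>
      sliceSpace (fun a z => restrictConfig Sᶜ (glue N a z)) fun _ => W := by
  ext ψ
  simp only [mem_extend, mem_sliceSpace]
  constructor
  · intro h x z
    convert h fun j => if h : j.1 ∈ S then x ⟨j.1, h⟩ else z j using 3 with a
    ext j
    by_cases hj : j ∈ S
    · have : j ∉ N := fun h => Finset.disjoint_left.1 hN h hj
      simp [glue, hj, this]
    · simp [glue, hj]
  · intro h z
    convert h (fun j => z ⟨j.1, Finset.mem_compl.2 (Finset.disjoint_right.1 hN j.2)⟩) z using 3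
      with a
    ext j
    by_cases hj : j ∈ S
    · have : j ∉ N := Finset.disjoint_right.1 hN hj
      simp [glue, hj, this]
    · simp [glue, hj]

/-- A subspace acting on the qudits in `S` meets a sum of subspaces acting on qudits outside `S`
in at least the dimension of a tensor product. -/
theorem finrank_mul_le_finrank_inf_iSup {ι : Type*} (S : Finset (Fin n)) (N : ι → Finset (Fin n))
    (hN : ∀ i, Disjoint (N i) S) (V : Submodule ℂ (QuditSpace (restrictDims d S)))
    (W : (i : ι) → Submodule ℂ (QuditSpace (restrictDims d (N i)))) :
    Module.finrank ℂ V * Module.finrank ℂ (⨆ i, extend (N i) (W i) : Submodule ℂ (QuditSpace d)) ≤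
      Module.finrank ℂ (extend S V ⊓ ⨆ i, extend (N i) (W i) : Submodule ℂ (QuditSpace d)) *
        ∏ j ∈ S, d j := by
  have e : (⨆ i, extend (N i) (W i) : Submodule ℂ (QuditSpace d)) =
      sliceSpace (fun y x => glue S x y) fun _ =>
        ⨆ i, sliceSpace (fun a z => restrictConfig Sᶜ (glue (N i) a z)) fun _ => W i := by
    rw [sliceSpace_iSup]
    exact iSup_congr fun i => extend_eq_sliceSpace_of_disjoint (hN i) (W i)
  rw [e]
  generalize (⨆ i, sliceSpace (fun a z => restrictConfig Sᶜ (glue (N i) a z)) fun _ => W i) = Y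
  have h1 := finrank_mul_le_finrank_inf S V Y
  have hinj : Function.Injective fun p : Config (restrictDims d Sᶜ) × Config (restrictDims d S) =>
      glue S p.2 p.1 := (glue_injective (d := d) S).comp Prod.swap_injective
  have h2 := finrank_sliceSpace (ι := fun y x => glue S x y) hinj fun _ => Y
  rw [Finset.sum_const, Finset.card_univ, ← card_config_mul_compl d S] at h2
  have h3 : Module.finrank ℂ (sliceSpace (fun y x => glue S x y) fun _ => Y :
      Submodule ℂ (QuditSpace d)) = Module.finrank ℂ Y * ∏ j ∈ S, d j := by
    rw [← card_config_restrict]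
    have : (Module.finrank ℂ (sliceSpace (fun y x => glue S x y) fun _ => Y :
      Submodule ℂ (QuditSpace d)) : ℚ) =
        Module.finrank ℂ Y * Fintype.card (Config (restrictDims d S)) := by
      simp only [nsmul_eq_mul] at h2
      push_cast at h2 ⊢
      linarith
    exact_mod_cast this
  rw [h3, ← mul_assoc]
  exact Nat.mul_le_mul_right _ h1

/-- Adding a subspace acting on the qudits in `S` to a sum of subspaces acting on the qudits outside
`S`. -/
theorem relDim_sub_inf_le (hd : ∀ j, 0 < d j) {ι : Type*} (S : Finset (Fin n))
    (N : ι → Finset (Fin n)) (hN : ∀ i, Disjoint (N i) S)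
    (V : Submodule ℂ (QuditSpace (restrictDims d S)))
    (W : (i : ι) → Submodule ℂ (QuditSpace (restrictDims d (N i))))
    (X : Submodule ℂ (QuditSpace d)) (hX : (⨆ i, extend (N i) (W i)) ≤ X) :
    relDim (X ⊔ extend S V) ≤
      relDim X + relDim V * (1 - relDim (⨆ i, extend (N i) (W i) : Submodule ℂ (QuditSpace d))) := by
  have h1 := finrank_mul_le_finrank_inf_iSup S N hN V W
  have h2 := Submodule.finrank_sup_add_finrank_inf_eq X (extend S V)
  have h3 : Module.finrank ℂ (extend S V ⊓ ⨆ i, extend (N i) (W i) : Submodule ℂ (QuditSpace d)) ≤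
      Module.finrank ℂ (X ⊓ extend S V : Submodule ℂ (QuditSpace d)) :=
    Submodule.finrank_mono (le_inf (inf_le_right.trans hX) inf_le_left)
  have h4 := relDim_extend hd S V
  have hS : (0 : ℚ) < ((∏ j ∈ S, d j : ℕ) : ℚ) := by
    exact_mod_cast Finset.prod_pos fun j _ => hd j
  have hH : (0 : ℚ) < (Fintype.card (Config d) : ℚ) := by
    rw [card_config]; exact_mod_cast Finset.prod_pos fun j _ => hd j
  have h1' := h1.trans (Nat.mul_le_mul_right _ h3)
  have key : relDim V * relDim (⨆ i, extend (N i) (W i) : Submodule ℂ (QuditSpace d)) ≤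
      relDim (X ⊓ extend S V) := by
    rw [relDim_eq, relDim_eq, relDim_eq, card_config_restrict, div_mul_div_comm,
      div_le_div_iff₀ (by positivity) hH]
    have : ((Module.finrank ℂ V * Module.finrank ℂ (⨆ i, extend (N i) (W i) :
        Submodule ℂ (QuditSpace d)) : ℕ) : ℚ) ≤
        ((Module.finrank ℂ (X ⊓ extend S V : Submodule ℂ (QuditSpace d)) * ∏ j ∈ S, d j : ℕ) : ℚ) := by
      exact_mod_cast h1'
    rw [Nat.cast_mul, Nat.cast_mul] at this
    rw [← mul_assoc]
    gcongr
  have h2' : relDim (X ⊔ extend S V) + relDim (X ⊓ extend S V) = relDim X + relDim V := by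
    rw [← h4, relDim_eq, relDim_eq, relDim_eq, relDim_eq, ← add_div, ← add_div]
    congr 1
    exact_mod_cast h2
  linarith

end Extend

/-! ### Generic rank: from one example to almost all unitaries -/

section Generic

/-- The zero set of a determinant that depends linearly on a vector is a null set or everything. -/
theorem ae_det_ne_zero {E κ : Type*} [NormedAddCommGroup E] [NormedSpace ℂ E]
    [FiniteDimensional ℂ E] [MeasurableSpace E] [BorelSpace E] [Fintype κ] [DecidableEq κ]
    (μ : Measure E) [μ.IsAddHaarMeasure] (Λ : E →ₗ[ℂ] Matrix κ κ ℂ) {x₀ : E}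
    (hx₀ : (Λ x₀).det ≠ 0) : ∀ᵐ x ∂μ, (Λ x).det ≠ 0 := by
  let _ : NormedSpace ℝ E := NormedSpace.restrictScalars ℝ ℂ E
  have : IsScalarTower ℝ ℂ E := ⟨fun a b x => by
    rw [Complex.real_smul, mul_smul]; rfl⟩
  have : FiniteDimensional ℝ E := FiniteDimensional.trans ℝ ℂ E
  have : ProperSpace E := FiniteDimensional.proper ℝ E
  have hc : Continuous fun x => (Λ x).det := by
    have : Continuous Λ := LinearMap.continuous_of_finiteDimensional Λ
    exact this.matrix_det
  have hS : MeasurableSet {q : E × ℝ | (Λ (x₀ + q.2 • q.1)).det = 0} := by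
    refine (isClosed_eq (hc.comp ?_) continuous_const).measurableSet
    fun_prop
  -- On each line `x₀ + t x` the determinant is a polynomial in `t` that is nonzero at `t = 0`, so
  -- its zeros are finitely many.
  have h0 : (μ.prod volume) {q : E × ℝ | (Λ (x₀ + q.2 • q.1)).det = 0} = 0 := by
    rw [Measure.measure_prod_null hS]
    refine Filter.Eventually.of_forall fun x => ?_
    let q : Polynomial ℂ := ((Λ x₀).map Polynomial.C + (Polynomial.X : Polynomial ℂ) •
      (Λ x).map Polynomial.C).det
    have hq : ∀ t : ℝ, (Λ (x₀ + t • x)).det = q.eval (t : ℂ) := by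
      intro t
      rw [← Polynomial.coe_evalRingHom, RingHom.map_det]
      congr 1
      ext a b
      have : (t • x) = (t : ℂ) • x := by
        rw [← algebraMap_smul ℂ t x]; rfl
      rw [this, map_add, map_smul]
      simp
      ring
    have hq0 : q ≠ 0 := by
      intro h
      have := hq 0
      rw [h] at this
      simp at this
      exact hx₀ this
    have hfin : (Prod.mk x ⁻¹' {q : E × ℝ | (Λ (x₀ + q.2 • q.1)).det = 0}).Finite := by
      have h1 : {z : ℂ | q.IsRoot z}.Finite := Polynomial.finite_setOfPred_isRoot hq0
      refine Set.Finite.subset (h1.preimage (Complex.ofReal_injective.injOn)) ?_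
      intro t ht
      simp only [Set.mem_preimage, Set.mem_ofPred_eq] at ht ⊢
      rw [hq] at ht
      exact ht
    exact hfin.measure_zero _
  have h1 : (Measure.prod volume μ) {q : ℝ × E | (Λ (x₀ + q.1 • q.2)).det = 0} = 0 := by
    have := (Measure.measurePreserving_swap (μ := (volume : Measure ℝ)) (ν := μ)).measure_preimage
      hS.nullMeasurableSet
    rw [h0] at this
    exact this
  have h2 := Measure.measure_ae_null_of_prod_null h1
  have h3 : ∀ᵐ t : ℝ, t ≠ 0 := by
    simp [ae_iff]
  -- By Fubini, for some `t ≠ 0` the set of bad directions `x` is null; its image under the affine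
  -- map `x ↦ x₀ + t x` is the zero set in question.
  obtain ⟨t, ht, ht0⟩ := (h2.and h3).exists
  have h4 : Prod.mk t ⁻¹' {q : ℝ × E | (Λ (x₀ + q.1 • q.2)).det = 0} =
      (t • ·) ⁻¹' ((x₀ + ·) ⁻¹' {x | (Λ x).det = 0}) := rfl
  simp only [h4] at ht
  simp only [Pi.zero_apply, Measure.addHaar_preimage_smul μ ht0, measure_preimage_add,
    mul_eq_zero] at ht
  rw [ae_iff]
  simp only [not_not]
  rcases ht with ht | ht
  · exfalso
    rw [ENNReal.ofReal_eq_zero] at ht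
    have : 0 < |(t ^ Module.finrank ℝ E)⁻¹| := by positivity
    linarith
  · exact ht

instance secondCountable_unitaryGroup {A : Type*} [Fintype A] [DecidableEq A] :
    SecondCountableTopology (Matrix.unitaryGroup A ℂ) := by
  have : SecondCountableTopology (Matrix A A ℂ) :=
    inferInstanceAs (SecondCountableTopology (A → A → ℂ))
  exact TopologicalSpace.Subtype.secondCountableTopology _

instance isHaarMeasure_haarUnitary {A : Type*} [Fintype A] [DecidableEq A] :
    (haarUnitary A).IsHaarMeasure :=
  inferInstanceAs (Measure.haarMeasure ⊤).IsHaarMeasure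

instance isMulRightInvariant_haarUnitary {A : Type*} [Fintype A] [DecidableEq A] :
    (haarUnitary A).IsMulRightInvariant := by
  constructor
  intro g
  have : IsProbabilityMeasure ((haarUnitary A).map (· * g)) :=
    Measure.isProbabilityMeasure_map (measurable_mul_const g).aemeasurable
  have h := Measure.isMulInvariant_eq_smul_of_compactSpace ((haarUnitary A).map (· * g))
    (haarUnitary A)
  have h1 := congrArg (fun μ => μ Set.univ) h
  simp only [measure_univ, Measure.smul_apply] at h1
  rw [h]
  have : ((haarUnitary A).map (· * g)).haarScalarFactor (haarUnitary A) = 1 := by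
    have h2 : (1 : ENNReal) =
        (((haarUnitary A).map (· * g)).haarScalarFactor (haarUnitary A) : ENNReal) := by
      simpa [ENNReal.smul_def] using h1
    exact_mod_cast h2.symm
  rw [this, one_smul]

/-- An isometry between subspaces of equal dimension extends to the whole finite-dimensional space.
-/
theorem exists_unitary_map_eq {A : Type*} [Fintype A] [DecidableEq A]
    {W W' : Submodule ℂ (A → ℂ)} (h : Module.finrank ℂ W = Module.finrank ℂ W') :
    ∃ Q : Matrix.unitaryGroup A ℂ, rotate Q W = W' := by
  let e := WithLp.linearEquiv 2 ℂ (A → ℂ)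
  let S : Submodule ℂ (EuclideanSpace ℂ A) := W.map (e.symm : (A → ℂ) →ₗ[ℂ] EuclideanSpace ℂ A)
  let S' : Submodule ℂ (EuclideanSpace ℂ A) := W'.map (e.symm : (A → ℂ) →ₗ[ℂ] EuclideanSpace ℂ A)
  have hS : Module.finrank ℂ S = Module.finrank ℂ S' := by
    rw [LinearEquiv.finrank_map_eq, LinearEquiv.finrank_map_eq, h]
  let L : S ≃ₗᵢ[ℂ] S' :=
    (stdOrthonormalBasis ℂ S).equiv (stdOrthonormalBasis ℂ S') (finCongr hS)
  let F : EuclideanSpace ℂ A →ₗᵢ[ℂ] EuclideanSpace ℂ A := (S'.subtypeₗᵢ.comp L.toLinearIsometry).extend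
  let F' : EuclideanSpace ℂ A ≃ₗᵢ[ℂ] EuclideanSpace ℂ A := F.toLinearIsometryEquiv rfl
  let b := EuclideanSpace.basisFun A ℂ
  let Q : Matrix A A ℂ := LinearMap.toMatrix b.toBasis b.toBasis F'.toLinearEquiv.toLinearMap
  have hQ : Q ∈ Matrix.unitaryGroup A ℂ := F'.toMatrix_mem_unitaryGroup b b
  have hQF : ∀ x : A → ℂ, Q.mulVec x = e (F (e.symm x)) := by
    intro x
    have := LinearMap.toMatrix_mulVec_repr b.toBasis b.toBasis F'.toLinearEquiv.toLinearMap
      (e.symm x)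
    exact this
  have hF : ∀ s (hs : s ∈ S), F s = L ⟨s, hs⟩ := fun s hs =>
    (S'.subtypeₗᵢ.comp L.toLinearIsometry).extend_apply ⟨s, hs⟩
  refine ⟨⟨Q, hQ⟩, ?_⟩
  refine Submodule.eq_of_le_of_finrank_eq ?_ ?_
  · rintro _ ⟨w, hw, rfl⟩
    change Q.mulVec w ∈ W'
    have hw1 : e.symm w ∈ S := Submodule.mem_map_of_mem hw
    rw [hQF, hF _ hw1]
    obtain ⟨w', hw', h'⟩ := (L ⟨e.symm w, hw1⟩).2
    rw [← h']
    simpa using hw'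
  · refine Eq.trans ?_ h
    refine (Submodule.equivMapOfInjective _ ?_ W).finrank_eq.symm
    intro x y hxy
    change Q.mulVec x = Q.mulVec y at hxy
    rw [hQF, hQF] at hxy
    exact e.symm.injective (F.injective (e.injective hxy))

variable {ι : Type*} [Fintype ι] {A : ι → Type*} [∀ i, Fintype (A i)] [∀ i, DecidableEq (A i)]

/-- A property of the subspaces `U_i W_i` implied by the nonvanishing of a determinant holds almost
surely once the determinant is nonzero for some matrices in place of the unitaries. -/
theorem ae_rotate_of_det_ne_zero {κ : Type*} [Fintype κ] [DecidableEq κ]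
    (W : (i : ι) → Submodule ℂ (A i → ℂ)) (P : ((i : ι) → Submodule ℂ (A i → ℂ)) → Prop)
    (Λ : ((i : ι) → A i → A i → ℂ) →ₗ[ℂ] Matrix κ κ ℂ)
    (hΛ : ∀ M : (i : ι) → Matrix (A i) (A i) ℂ, (Λ M).det ≠ 0 →
      P fun i => (W i).map (Matrix.mulVecLin (M i)))
    (M₀ : (i : ι) → Matrix (A i) (A i) ℂ) (h₀ : (Λ M₀).det ≠ 0) :
    ∀ᵐ U ∂(Measure.pi fun i => haarUnitary (A i)), P fun i => rotate (U i) (W i) := by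
  let E := (i : ι) → A i → A i → ℂ
  have : ProperSpace E := FiniteDimensional.proper ℂ E
  let μ : Measure E := Measure.addHaar
  let H := Measure.pi fun i => haarUnitary (A i)
  let mulU (U : (i : ι) → Matrix.unitaryGroup (A i) ℂ) : E →ₗ[ℂ] E :=
    { toFun := fun G i => ((U i : Matrix (A i) (A i) ℂ) * Matrix.of (G i) : Matrix (A i) (A i) ℂ)
      map_add' := fun G G' => by
        funext i
        exact Matrix.mul_add _ _ _
      map_smul' := fun c G => by
        funext i
        exact Matrix.mul_smul (U i : Matrix (A i) (A i) ℂ) c (Matrix.of (G i)) }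
  have hΛc : Continuous Λ := LinearMap.continuous_of_finiteDimensional Λ
  have hmeas : MeasurableSet {q : ((i : ι) → Matrix.unitaryGroup (A i) ℂ) × E |
      (Λ (mulU q.1 q.2)).det = 0} := by
    refine (isClosed_eq ?_ continuous_const).measurableSet
    refine Continuous.matrix_det (hΛc.comp ?_)
    refine continuous_pi fun i => ?_
    have h1 : Continuous fun q : ((i : ι) → Matrix.unitaryGroup (A i) ℂ) × E =>
        (q.1 i : Matrix (A i) (A i) ℂ) :=
      continuous_subtype_val.comp ((continuous_apply i).comp continuous_fst)
    have h2 : Continuous fun q : ((i : ι) → Matrix.unitaryGroup (A i) ℂ) × E =>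
        (Matrix.of (q.2 i) : Matrix (A i) (A i) ℂ) :=
      (continuous_apply i).comp continuous_snd
    exact h1.matrix_mul h2
  -- For fixed `U`, the determinant at `U G` is nonzero for almost every `G`, because `G = U* M₀` is
  -- a good point. Fubini then yields one invertible `G` that is good for almost every `U`.
  have hnull : (H.prod μ) {q | (Λ (mulU q.1 q.2)).det = 0} = 0 := by
    rw [Measure.measure_prod_null hmeas]
    refine Filter.Eventually.of_forall fun U => ?_
    have := ae_det_ne_zero μ (Λ ∘ₗ mulU U)
      (x₀ := fun i => ((star (U i : Matrix (A i) (A i) ℂ)) * M₀ i : Matrix (A i) (A i) ℂ)) ?_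
    · rw [ae_iff] at this
      simpa using this
    · have : mulU U (fun i => ((star (U i : Matrix (A i) (A i) ℂ)) * M₀ i :
          Matrix (A i) (A i) ℂ)) = M₀ := by
        funext i
        change (U i : Matrix (A i) (A i) ℂ) * (star (U i : Matrix (A i) (A i) ℂ) * M₀ i) = M₀ i
        rw [← Matrix.mul_assoc, Matrix.mem_unitaryGroup_iff.1 (U i).2, Matrix.one_mul]
      change (Λ (mulU U (fun i => ((star (U i : Matrix (A i) (A i) ℂ)) * M₀ i :
          Matrix (A i) (A i) ℂ)))).det ≠ 0
      rw [this]
      exact h₀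
  have hnull' : (μ.prod H) {q | (Λ (mulU q.2 q.1)).det = 0} = 0 := by
    have := (Measure.measurePreserving_swap (μ := μ) (ν := H)).measure_preimage
      hmeas.nullMeasurableSet
    rw [hnull] at this
    exact this
  have h2 := Measure.measure_ae_null_of_prod_null hnull'
  have hinv : ∀ᵐ G ∂μ, ∀ i, (Matrix.of (G i)).det ≠ 0 := by
    rw [ae_all_iff]
    intro i
    exact ae_det_ne_zero μ (LinearMap.proj i : E →ₗ[ℂ] (A i → A i → ℂ))
      (x₀ := fun i => (1 : Matrix (A i) (A i) ℂ)) (by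
        change (1 : Matrix (A i) (A i) ℂ).det ≠ 0
        simp)
  obtain ⟨G, hG, hGinv⟩ := (h2.and hinv).exists
  have hG' : ∀ᵐ U ∂H, (Λ (mulU U G)).det ≠ 0 := by
    rw [ae_iff]
    simpa using hG
  -- The invertible matrix `G` acts on the given subspaces as a unitary `Q` does, so right
  -- invariance of Haar measure removes it: `U Q⁻¹ G W = U W`.
  have hQ : ∀ i, ∃ Q : Matrix.unitaryGroup (A i) ℂ,
      rotate Q (W i) = (W i).map (Matrix.mulVecLin (Matrix.of (G i))) := by
    intro i
    apply exists_unitary_map_eq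
    refine (Submodule.equivMapOfInjective _ ?_ (W i)).finrank_eq
    exact Matrix.mulVec_injective_iff_isUnit.2
      ((Matrix.isUnit_iff_isUnit_det _).2 (isUnit_iff_ne_zero.2 (hGinv i)))
  choose Q hQ using hQ
  have hpres : MeasurePreserving (fun U : (i : ι) → Matrix.unitaryGroup (A i) ℂ => U * Q⁻¹) H H :=
    measurePreserving_mul_right H Q⁻¹
  have h3 := hpres.quasiMeasurePreserving.ae hG'
  filter_upwards [h3] with U hU
  have := hΛ _ hU
  convert this using 2 with i
  have e : W i = ((W i).map (Matrix.mulVecLin (Matrix.of (G i)))).map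
      (Matrix.mulVecLin ((Q i)⁻¹ : Matrix.unitaryGroup (A i) ℂ).1) := by
    rw [← hQ i, rotate, ← Submodule.map_comp, ← Matrix.mulVecLin_mul]
    have : ((Q i)⁻¹ : Matrix.unitaryGroup (A i) ℂ).1 * (Q i).1 = 1 := by
      rw [← Submonoid.coe_mul, inv_mul_cancel]; rfl
    rw [this, Matrix.mulVecLin_one, Submodule.map_id]
  rw [rotate]
  conv_lhs => rw [e]
  rw [← Submodule.map_comp, ← Submodule.map_comp, ← Matrix.mulVecLin_mul, ← Matrix.mulVecLin_mul]
  rfl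

end Generic

theorem exists_le_finrank_eq {V : Type*} [AddCommGroup V] [Module ℂ V] [FiniteDimensional ℂ V]
    (W : Submodule ℂ V) {k : ℕ} (hk : k ≤ Module.finrank ℂ W) :
    ∃ W' ≤ W, Module.finrank ℂ W' = k := by
  let b := Module.finBasis ℂ W
  let v : Fin k → V := fun i => (b (Fin.castLE hk i) : V)
  have hv : LinearIndependent ℂ v :=
    (b.linearIndependent.map' W.subtype W.ker_subtype).comp _ (Fin.castLE_injective hk)
  refine ⟨Submodule.span ℂ (Set.range v), Submodule.span_le.2 ?_, ?_⟩
  · rintro _ ⟨i, rfl⟩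
    exact (b (Fin.castLE hk i)).2
  · rw [finrank_span_eq_card hv, Fintype.card_fin]

theorem exists_ge_finrank_eq {V : Type*} [AddCommGroup V] [Module ℂ V] [FiniteDimensional ℂ V]
    (W : Submodule ℂ V) {k : ℕ} (hk : Module.finrank ℂ W ≤ k) (hk' : k ≤ Module.finrank ℂ V) :
    ∃ W', W ≤ W' ∧ Module.finrank ℂ W' = k := by
  obtain ⟨C, hC⟩ := W.exists_isCompl
  have h1 := Submodule.finrank_add_eq_of_isCompl hC
  obtain ⟨C', hC', hk2⟩ := exists_le_finrank_eq C (k := k - Module.finrank ℂ W) (by omega)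
  refine ⟨W ⊔ C', le_sup_left, ?_⟩
  have h2 := Submodule.finrank_sup_add_finrank_inf_eq W C'
  have h3 : W ⊓ C' = ⊥ := by
    rw [eq_bot_iff, ← hC.inf_eq_bot]
    exact inf_le_inf_left _ hC'
  rw [h3, finrank_bot] at h2
  omega

theorem exists_matrix_map_eq {A : Type*} [Fintype A] [DecidableEq A]
    {W W' : Submodule ℂ (A → ℂ)} (h : Module.finrank ℂ W' ≤ Module.finrank ℂ W) :
    ∃ M : Matrix A A ℂ, W' ≤ W.map (Matrix.mulVecLin M) := by
  obtain ⟨W₂, hle, hf⟩ := exists_le_finrank_eq W h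
  let L : W₂ ≃ₗ[ℂ] W' := LinearEquiv.ofFinrankEq _ _ hf
  obtain ⟨g, hg⟩ := LinearMap.exists_extend (W'.subtype ∘ₗ L.toLinearMap)
  refine ⟨LinearMap.toMatrix' g, ?_⟩
  intro w hw
  refine ⟨L.symm ⟨w, hw⟩, hle (L.symm ⟨w, hw⟩).2, ?_⟩
  have := LinearMap.congr_fun hg (L.symm ⟨w, hw⟩)
  simpa using this

theorem finrank_rotate {A : Type*} [Fintype A] [DecidableEq A] (Q : Matrix.unitaryGroup A ℂ)
    (X : Submodule ℂ (A → ℂ)) : Module.finrank ℂ (rotate Q X) = Module.finrank ℂ X :=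
  (Submodule.equivMapOfInjective _ (Matrix.mulVec_injective_iff_isUnit.2
    ⟨Unitary.toUnits Q, rfl⟩) X).finrank_eq.symm

/-- Lower semicontinuity of rank: linear independence of finitely many vectors depending linearly on
the matrices is implied by a nonvanishing determinant. Matrices mapping `W` onto spaces that contain
`W'` show that this determinant is not identically zero. -/
theorem ae_finrank_iSup_extend_le {m n : ℕ} (N : Fin m → Finset (Fin n)) (d : Fin n → ℕ)
    (W W' : (i : Fin m) → Submodule ℂ (QuditSpace (restrictDims d (N i))))
    (h : ∀ i, Module.finrank ℂ (W' i) ≤ Module.finrank ℂ (W i)) :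
    ∀ᵐ U ∂(Measure.pi fun i : Fin m => haarUnitary (Config (restrictDims d (N i)))),
      Module.finrank ℂ (⨆ i, extend (N i) (W' i) : Submodule ℂ (QuditSpace d)) ≤
        Module.finrank ℂ (⨆ i, extend (N i) (rotate (U i) (W i)) : Submodule ℂ (QuditSpace d)) := by
  choose M₀ hM₀ using fun i => exists_matrix_map_eq (h i)
  let g (i : Fin m) (φ : QuditSpace (restrictDims d (N i)))
      (χ : QuditSpace (restrictDims d (N i)ᶜ)) :
      ((i : Fin m) → Config (restrictDims d (N i)) → Config (restrictDims d (N i)) → ℂ) →ₗ[ℂ]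
        QuditSpace d :=
    { toFun := fun M x => (∑ b, M i (restrictConfig (N i) x) b * φ b) * χ (restrictConfig (N i)ᶜ x)
      map_add' := fun M M' => by
        ext x
        simp [add_mul, Finset.sum_add_distrib]
      map_smul' := fun c M => by
        ext x
        simp [Finset.mul_sum, mul_assoc, Finset.sum_mul] }
  have hgmem : ∀ (M : (i : Fin m) → Matrix (Config (restrictDims d (N i)))
      (Config (restrictDims d (N i))) ℂ) (i : Fin m), ∀ φ ∈ W i, ∀ χ,
      g i φ χ M ∈ ⨆ i, extend (N i) ((W i).map (Matrix.mulVecLin (M i))) := by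
    intro M i φ hφ χ
    exact Submodule.mem_iSup_of_mem i (prod_mem_extend (φ := Matrix.mulVecLin (M i) φ)
      (Submodule.mem_map_of_mem hφ) χ)
  let s : Set (QuditSpace d) := {ψ | ∃ i, ∃ φ ∈ W i, ∃ χ, g i φ χ M₀ = ψ}
  have hs : (⨆ i, extend (N i) (W' i)) ≤ Submodule.span ℂ s := by
    refine iSup_le fun i => Submodule.span_le.2 ?_
    rintro _ ⟨φ', hφ', χ, rfl⟩
    obtain ⟨φ, hφ, rfl⟩ := hM₀ i hφ'
    exact Submodule.subset_span ⟨i, φ, hφ, χ, rfl⟩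
  obtain ⟨f, hfs, -, hfi⟩ := Submodule.exists_fun_fin_finrank_span_eq ℂ s
  choose i φ hφ χ hf using hfs
  -- `T` reads off coordinates with respect to the basis `f` found at `M₀`, so that `Λ M₀` is the
  -- identity.
  obtain ⟨T, hT⟩ := LinearMap.exists_leftInverse_of_injective (Fintype.linearCombination ℂ f)
    (LinearMap.ker_eq_bot.2 (linearIndependent_iff_injective_fintypeLinearCombination.1 hfi))
  let Λ : ((i : Fin m) → Config (restrictDims d (N i)) → Config (restrictDims d (N i)) → ℂ) →ₗ[ℂ]
      Matrix (Fin (Module.finrank ℂ (Submodule.span ℂ s)))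
        (Fin (Module.finrank ℂ (Submodule.span ℂ s))) ℂ :=
    { toFun := fun M => Matrix.of fun l k => T (g (i k) (φ k) (χ k) M) l
      map_add' := fun M M' => by
        ext l k
        simp
      map_smul' := fun c M => by
        ext l k
        simp }
  refine ae_rotate_of_det_ne_zero W (fun V => Module.finrank ℂ (⨆ i, extend (N i) (W' i) :
    Submodule ℂ (QuditSpace d)) ≤ Module.finrank ℂ (⨆ i, extend (N i) (V i) :
      Submodule ℂ (QuditSpace d))) Λ ?_ M₀ ?_
  · intro M hM
    have hli : LinearIndependent ℂ fun k => g (i k) (φ k) (χ k) M := by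
      rw [Fintype.linearIndependent_iff]
      intro c hc
      have : (Λ M).mulVec c = 0 := by
        ext l
        have := congrFun (congrArg T hc) l
        simpa [Λ, Matrix.mulVec, dotProduct, mul_comm] using this
      exact congrFun (Matrix.eq_zero_of_mulVec_eq_zero hM this)
    calc _ ≤ _ := Submodule.finrank_mono hs
      _ = Module.finrank ℂ (Submodule.span ℂ (Set.range fun k => g (i k) (φ k) (χ k) M)) := by
          rw [finrank_span_eq_card hli, Fintype.card_fin]
      _ ≤ _ := by
          refine Submodule.finrank_mono (Submodule.span_le.2 ?_)
          rintro _ ⟨k, rfl⟩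
          exact hgmem M (i k) (φ k) (hφ k) (χ k)
  · have : Λ M₀ = 1 := by
      ext l k
      have h1 := LinearMap.congr_fun hT (Pi.single k 1)
      have h2 : T (f k) = Pi.single k 1 := by
        simpa [Fintype.linearCombination_apply_single] using h1
      change T (g (i k) (φ k) (χ k) M₀) l = _
      rw [hf, h2, Matrix.one_apply, Pi.single_apply]
    rw [this]
    simp

theorem relDim_le_of_finrank_le {A : Type*} [Fintype A] {W W' : Submodule ℂ (A → ℂ)}
    (h : Module.finrank ℂ W ≤ Module.finrank ℂ W') : relDim W ≤ relDim W' := by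
  rw [relDim, relDim]
  gcongr

/-- Two lower bounds on dimensions of sums, each attained by some subspaces, are attained
simultaneously by subspaces that agree where the dimensions agree. -/
theorem exists_common_subspaces {m n : ℕ} (N : Fin m → Finset (Fin n)) (d : Fin n → ℕ)
    (C : Finset (Fin m)) (W W' : (i : Fin m) → Submodule ℂ (QuditSpace (restrictDims d (N i))))
    (h : ∀ i ∈ C, Module.finrank ℂ (W i) = Module.finrank ℂ (W' i)) :
    ∃ V V' : (i : Fin m) → Submodule ℂ (QuditSpace (restrictDims d (N i))),
      (∀ i, Module.finrank ℂ (V i) = Module.finrank ℂ (W i)) ∧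
      (∀ i, Module.finrank ℂ (V' i) = Module.finrank ℂ (W' i)) ∧
      (∀ i ∈ C, V i = V' i) ∧
      Module.finrank ℂ (⨆ i, extend (N i) (W i) : Submodule ℂ (QuditSpace d)) ≤
        Module.finrank ℂ (⨆ i, extend (N i) (V i) : Submodule ℂ (QuditSpace d)) ∧
      Module.finrank ℂ (⨆ i, extend (N i) (W' i) : Submodule ℂ (QuditSpace d)) ≤
        Module.finrank ℂ (⨆ i, extend (N i) (V' i) : Submodule ℂ (QuditSpace d)) := by
  classical
  -- Rotating both families by the same unitaries preserves equality on `C`, so the second family is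
  -- first replaced by one of the same dimensions that equals `W` on `C`.
  let W₂ := fun i => if i ∈ C then W i else W' i
  have hW₂ : ∀ i, Module.finrank ℂ (W₂ i) = Module.finrank ℂ (W' i) := by
    intro i
    by_cases hi : i ∈ C
    · rw [show W₂ i = W i from if_pos hi, h i hi]
    · rw [show W₂ i = W' i from if_neg hi]
  obtain ⟨U, h1, h2⟩ := ((ae_finrank_iSup_extend_le N d W W fun i => le_rfl).and
    (ae_finrank_iSup_extend_le N d W₂ W' fun i => (hW₂ i).ge)).exists
  refine ⟨fun i => rotate (U i) (W i), fun i => rotate (U i) (W₂ i), fun i => finrank_rotate _ _,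
    fun i => (finrank_rotate _ _).trans (hW₂ i), fun i hi => ?_, h1, h2⟩
  simp [W₂, hi]

/-! ### The independence polynomial and Shearer's bound -/

section IndepSum

variable {V : Type*} [DecidableEq V]

open Classical in
/-- The independence polynomial of the subgraph induced on `S`. -/
noncomputable def indepSum (H : SimpleGraph V) (x : V → ℚ) (S : Finset V) : ℚ :=
  ∑ T ∈ S.powerset.filter (fun T : Finset V => H.IsIndepSet (T : Set V)),
    (-1) ^ T.card * ∏ v ∈ T, x v

theorem indepSum_univ [Fintype V] (H : SimpleGraph V) (x : V → ℚ) :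
    indepSum H x Finset.univ = indepPoly H x := by
  rw [indepSum, indepPoly, Finset.powerset_univ]
  exact Finset.sum_congr (by ext; simp) fun _ _ => rfl

theorem indepPoly_induce (H : SimpleGraph V) (x : V → ℚ) (S : Finset V) :
    indepPoly (H.induce (S : Set V)) (fun v => x v) = indepSum H x S := by
  classical
  rw [indepSum, indepPoly]
  refine Finset.sum_bij' (fun T _ => T.map (Function.Embedding.subtype _))
    (fun T _ => T.subtype (· ∈ (S : Set V))) ?_ ?_ ?_ ?_ ?_
  · intro T hT
    simp only [Finset.mem_filter, Finset.mem_univ, true_and, Finset.mem_powerset] at hT ⊢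
    refine ⟨fun v hv => ?_, ?_⟩
    · obtain ⟨w, -, rfl⟩ := Finset.mem_map.1 hv
      exact w.2
    · intro a ha b hb hab
      simp only [Finset.coe_map, Set.mem_image] at ha hb
      obtain ⟨a, ha, rfl⟩ := ha
      obtain ⟨b, hb, rfl⟩ := hb
      exact hT ha hb fun h => hab (by rw [h])
  · intro T hT
    simp only [Finset.mem_filter, Finset.mem_univ, true_and, Finset.mem_powerset] at hT ⊢
    intro a ha b hb hab
    simp only [Finset.mem_coe, Finset.mem_subtype] at ha hb
    exact hT.2 ha hb fun h => hab (Subtype.ext h)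
  · intro T hT
    ext a
    simp
  · intro T hT
    simp only [Finset.mem_filter, Finset.mem_powerset] at hT
    ext a
    simp only [Finset.mem_map, Finset.mem_subtype, Function.Embedding.coe_subtype, Subtype.exists]
    constructor
    · rintro ⟨b, hb, h, rfl⟩
      exact h
    · intro h
      exact ⟨a, hT.1 h, h, rfl⟩
  · intro T hT
    simp

theorem indepSum_empty (H : SimpleGraph V) (x : V → ℚ) : indepSum H x ∅ = 1 := by
  classical
  rw [indepSum, Finset.powerset_empty, Finset.filter_singleton, if_pos] <;> simp

open Classical in
theorem indepSum_insert (H : SimpleGraph V) (x : V → ℚ) {S : Finset V} {v : V} (hv : v ∉ S) :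
    indepSum H x (insert v S) =
      indepSum H x S - x v * indepSum H x (S.filter fun w => ¬ H.Adj v w) := by
  have hdisj : Disjoint (S.powerset.filter (fun T : Finset V => H.IsIndepSet (T : Set V)))
      ((S.powerset.image (insert v)).filter (fun T : Finset V => H.IsIndepSet (T : Set V))) := by
    refine Finset.disjoint_filter_filter ?_
    rw [Finset.disjoint_left]
    intro T hT hT'
    obtain ⟨T', -, rfl⟩ := Finset.mem_image.1 hT'
    exact hv (Finset.mem_powerset.1 hT (Finset.mem_insert_self v T'))
  rw [indepSum, Finset.powerset_insert, Finset.filter_union, Finset.sum_union hdisj, sub_eq_add_neg]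
  congr 1
  rw [indepSum, Finset.mul_sum, ← Finset.sum_neg_distrib]
  symm
  refine Finset.sum_bij (fun T _ => insert v T) ?_ ?_ ?_ ?_
  · intro T hT
    simp only [Finset.mem_filter, Finset.mem_powerset, Finset.mem_image] at hT ⊢
    refine ⟨⟨T, fun w hw => (Finset.mem_filter.1 (hT.1 hw)).1, rfl⟩, ?_⟩
    rw [Finset.coe_insert]
    refine Set.Pairwise.insert hT.2 fun w hw _ => ?_
    have := (Finset.mem_filter.1 (hT.1 hw)).2
    exact ⟨this, fun h => this h.symm⟩
  · intro T hT T' hT' h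
    simp only [Finset.mem_filter, Finset.mem_powerset] at hT hT'
    have h1 : v ∉ T := fun h => hv (Finset.mem_filter.1 (hT.1 h)).1
    have h2 : v ∉ T' := fun h => hv (Finset.mem_filter.1 (hT'.1 h)).1
    rw [← Finset.erase_insert h1, ← Finset.erase_insert h2, h]
  · intro T hT
    simp only [Finset.mem_filter, Finset.mem_powerset, Finset.mem_image] at hT
    obtain ⟨⟨T', hT', rfl⟩, hind⟩ := hT
    have h1 : v ∉ T' := fun h => hv (hT' h)
    refine ⟨T', ?_, rfl⟩
    simp only [Finset.mem_filter, Finset.mem_powerset]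
    refine ⟨fun w hw => Finset.mem_filter.2 ⟨hT' hw, ?_⟩, ?_⟩
    · exact hind (by simp) (by simp [hw]) (by rintro rfl; exact h1 hw)
    · exact hind.mono (by simp)
  · intro T hT
    simp only [Finset.mem_filter, Finset.mem_powerset] at hT
    have h1 : v ∉ T := fun h => hv (Finset.mem_filter.1 (hT.1 h)).1
    rw [Finset.card_insert_of_notMem h1, Finset.prod_insert h1]
    ring

/-- `x` restricted to `S` is in Shearer's bound. -/
def InShearer (H : SimpleGraph V) (x : V → ℚ) (S : Finset V) : Prop :=
  ∀ T ⊆ S, 0 < indepSum H x T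

theorem not_beyondShearer_iff [Fintype V] (H : SimpleGraph V) (x : V → ℚ) :
    ¬ BeyondShearer H x ↔ InShearer H x Finset.univ := by
  simp only [BeyondShearer, InShearer, Finset.subset_univ, true_imp_iff, not_exists, not_le]
  refine forall_congr' fun S => ?_
  rw [← indepPoly_induce]

theorem InShearer.mono {H : SimpleGraph V} {x : V → ℚ} {S T : Finset V} (h : InShearer H x S)
    (hT : T ⊆ S) : InShearer H x T := fun R hR => h R (hR.trans hT)

open Classical in
/-- Comparison of a function on sets of vertices with the independence polynomial. -/
theorem indepSum_mul_le {H : SimpleGraph V} {x : V → ℚ} (hx : ∀ v, 0 ≤ x v) {f : Finset V → ℚ}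
    (h₀ : 0 < f ∅)
    (hf : ∀ S : Finset V, ∀ v ∉ S, (∀ T ⊆ S, 0 < f T) →
      f S - x v * f (S.filter fun w => ¬ H.Adj v w) ≤ f (insert v S)) (k : ℕ) :
    ∀ S : Finset V, S.card ≤ k → InShearer H x S → 0 < f S ∧
      ∀ T ⊆ S, indepSum H x S * f T ≤ f S * indepSum H x T := by
  induction k with
  | zero =>
    intro S hS _
    have : S = ∅ := by simpa using hS
    subst this
    refine ⟨h₀, fun T hT => ?_⟩
    rw [Finset.subset_empty.1 hT, mul_comm]
  | succ k ih =>
    -- In Shearer's bound, `f / I` does not decrease when a vertex is added. The induction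
    -- hypothesis compares the values at the nonneighbours of `v` with those at `S`, which is what
    -- the two recursions need.
    have step : ∀ S : Finset V, ∀ v ∉ S, S.card ≤ k → InShearer H x (insert v S) →
        0 < f (insert v S) ∧ indepSum H x (insert v S) * f S ≤ f (insert v S) * indepSum H x S := by
      intro S v hv hS hIS
      have hIS' := hIS.mono (Finset.subset_insert v S)
      have hpos : ∀ T ⊆ S, 0 < f T := fun T hT =>
        (ih T ((Finset.card_le_card hT).trans hS) (hIS'.mono hT)).1
      have h1 := hf S v hv hpos
      have h2 := (ih S hS hIS').2 _ (Finset.filter_subset (fun w => ¬ H.Adj v w) S)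
      have h3 := indepSum_insert H x hv
      have hI := hIS _ subset_rfl
      have hIS0 := hIS' _ subset_rfl
      have hfS := hpos S subset_rfl
      have key : indepSum H x (insert v S) * f S ≤ f (insert v S) * indepSum H x S := by
        calc _ = indepSum H x S * f S -
              x v * (f S * indepSum H x (S.filter fun w => ¬ H.Adj v w)) := by rw [h3]; ring
          _ ≤ indepSum H x S * f S -
              x v * (indepSum H x S * f (S.filter fun w => ¬ H.Adj v w)) := by
            have := mul_le_mul_of_nonneg_left h2 (hx v)
            linarith
          _ = (f S - x v * f (S.filter fun w => ¬ H.Adj v w)) * indepSum H x S := by ring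
          _ ≤ _ := mul_le_mul_of_nonneg_right h1 hIS0.le
      exact ⟨pos_of_mul_pos_left ((mul_pos hI hfS).trans_le key) hIS0.le, key⟩
    intro S hS hIS
    rcases S.eq_empty_or_nonempty with rfl | ⟨v, hv⟩
    · exact ih ∅ (by simp) hIS
    have hS' : (S.erase v).card ≤ k := by rw [Finset.card_erase_of_mem hv]; omega
    have hpos : 0 < f S := by
      have := step (S.erase v) v (Finset.notMem_erase v S) hS' (by rwa [Finset.insert_erase hv])
      rw [Finset.insert_erase hv] at this
      exact this.1
    refine ⟨hpos, fun T hT => ?_⟩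
    rcases hT.eq_or_ssubset with rfl | hT
    · rw [mul_comm]
    obtain ⟨w, hw, hwT⟩ := Finset.exists_of_ssubset hT
    have h1 := (step (S.erase w) w (Finset.notMem_erase w S)
      (by rw [Finset.card_erase_of_mem hw]; omega) (by rwa [Finset.insert_erase hw])).2
    rw [Finset.insert_erase hw] at h1
    have hE : InShearer H x (S.erase w) := hIS.mono (Finset.erase_subset w S)
    have h2 := (ih (S.erase w) (by rw [Finset.card_erase_of_mem hw]; omega) hE).2 T
      (Finset.subset_erase.2 ⟨hT.1, hwT⟩)
    have hE0 := hE _ subset_rfl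
    have hI := hIS _ subset_rfl
    have hIT := hIS T hT.1
    refine le_of_mul_le_mul_left ?_ hE0
    calc indepSum H x (S.erase w) * (indepSum H x S * f T)
        = indepSum H x S * (indepSum H x (S.erase w) * f T) := by ring
      _ ≤ indepSum H x S * (f (S.erase w) * indepSum H x T) :=
          mul_le_mul_of_nonneg_left h2 hI.le
      _ = (indepSum H x S * f (S.erase w)) * indepSum H x T := by ring
      _ ≤ (f S * indepSum H x (S.erase w)) * indepSum H x T :=
          mul_le_mul_of_nonneg_right h1 hIT.le
      _ = _ := by ring

open Classical in
theorem indepSum_le_of_recursion {H : SimpleGraph V} {x : V → ℚ} (hx : ∀ v, 0 ≤ x v)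
    {f : Finset V → ℚ} (h₀ : f ∅ = 1)
    (hf : ∀ S : Finset V, ∀ v ∉ S, (∀ T ⊆ S, 0 < f T) →
      f S - x v * f (S.filter fun w => ¬ H.Adj v w) ≤ f (insert v S)) {S : Finset V}
    (hS : InShearer H x S) : indepSum H x S ≤ f S := by
  have := (indepSum_mul_le hx (by rw [h₀]; exact one_pos) hf S.card S le_rfl hS).2 ∅ (by simp)
  simpa [h₀, indepSum_empty] using this

/-- The polynomial for the smaller vector `x` itself satisfies the recursive inequality for `y`, as
long as its values are positive. -/
theorem indepSum_anti {H : SimpleGraph V} {x y : V → ℚ} (hx : ∀ v, 0 ≤ x v)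
    (hxy : ∀ v, x v ≤ y v) {S : Finset V} (hS : InShearer H y S) :
    indepSum H y S ≤ indepSum H x S := by
  classical
  refine indepSum_le_of_recursion (fun v => (hx v).trans (hxy v)) (indepSum_empty H x) ?_ hS
  intro S v hv hpos
  rw [indepSum_insert H x hv]
  have := mul_le_mul_of_nonneg_right (hxy v) (hpos _ (Finset.filter_subset
    (fun w => ¬ H.Adj v w) S)).le
  linarith

theorem InShearer.anti {H : SimpleGraph V} {x y : V → ℚ} (hx : ∀ v, 0 ≤ x v)
    (hxy : ∀ v, x v ≤ y v) {S : Finset V} (hS : InShearer H y S) : InShearer H x S := fun T hT =>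
  (hS T hT).trans_le (indepSum_anti hx hxy (hS.mono hT))

theorem indepSum_le_one {H : SimpleGraph V} {x : V → ℚ} (hx : ∀ v, 0 ≤ x v) {S : Finset V}
    (hS : InShearer H x S) : indepSum H x S ≤ 1 := by
  classical
  refine indepSum_le_of_recursion hx rfl (f := fun _ => 1) ?_ hS
  intro S v hv hpos
  simpa using hx v

theorem exists_int_pow_mul_indepSum {H : SimpleGraph V} {x : V → ℚ} {q : ℕ}
    (hx : ∀ v, ∃ p : ℤ, q * x v = p) (S : Finset V) {k : ℕ} (hk : S.card ≤ k) :
    ∃ p : ℤ, (q : ℚ) ^ k * indepSum H x S = p := by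
  classical
  choose p hp using hx
  refine ⟨∑ T ∈ S.powerset.filter (fun T : Finset V => H.IsIndepSet (T : Set V)),
    (-1) ^ T.card * (q ^ (k - T.card) * ∏ v ∈ T, p v), ?_⟩
  rw [indepSum, Finset.mul_sum]
  push_cast
  refine Finset.sum_congr rfl fun T hT => ?_
  have hT' : T.card ≤ k :=
    (Finset.card_le_card (Finset.mem_powerset.1 (Finset.mem_filter.1 hT).1)).trans hk
  have h1 : ∏ v ∈ T, (p v : ℚ) = q ^ T.card * ∏ v ∈ T, x v := by
    rw [← Finset.prod_congr rfl fun v _ => hp v, Finset.prod_mul_distrib, Finset.prod_const]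
  rw [h1, ← mul_assoc ((q : ℚ) ^ (k - T.card)), ← pow_add, Nat.sub_add_cancel hT']
  ring

end IndepSum

/-! ### Shearer's bound for subspaces -/

section UpperBound

variable {m n : ℕ} {E : Finset (Fin m × Fin n)}

theorem disjoint_nbr_of_not_adj {i v : Fin m} (hne : i ≠ v) (h : ¬ (depGraph E).Adj v i) :
    Disjoint (nbr E i) (nbr E v) := by
  rw [Finset.disjoint_iff_inter_eq_empty, Finset.inter_comm]
  by_contra h'
  exact h ⟨hne.symm, Finset.nonempty_iff_ne_empty.2 h'⟩

/-- Adding the subspace of the vertex `v` to subspaces including those not adjacent to `v`. -/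
theorem relDim_sup_extend_le {d : Fin n → ℕ} (hd : ∀ j, 0 < d j) {v : Fin m} {S : Finset (Fin m)}
    (hS : ∀ w ∈ S, w ≠ v ∧ ¬ (depGraph E).Adj v w)
    (W : (i : Fin m) → Submodule ℂ (QuditSpace (restrictDims d (nbr E i))))
    (U : Submodule ℂ (QuditSpace (restrictDims d (nbr E v))))
    {X : Submodule ℂ (QuditSpace d)} (hX : ⨆ i ∈ S, extend (nbr E i) (W i) ≤ X) :
    relDim (X ⊔ extend (nbr E v) U) ≤ relDim X + relDim U *
      (1 - relDim (⨆ i ∈ S, extend (nbr E i) (W i) : Submodule ℂ (QuditSpace d))) := by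
  have e : (⨆ i ∈ S, extend (nbr E i) (W i) : Submodule ℂ (QuditSpace d)) =
      ⨆ i : S, extend (nbr E i) (W i) := iSup_subtype'
  rw [e] at hX ⊢
  exact relDim_sub_inf_le hd (nbr E v) (fun i : S => nbr E i)
    (fun i => disjoint_nbr_of_not_adj (hS i i.2).1 (hS i i.2).2) U (fun i : S => W i) X hX

/-- Shearer's bound for subspaces. -/
theorem relDim_iSup_le {d : Fin n → ℕ} (hd : ∀ j, 0 < d j) {r : Fin m → ℚ}
    (hr : ∀ i, 0 ≤ r i) (W : (i : Fin m) → Submodule ℂ (QuditSpace (restrictDims d (nbr E i))))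
    (hW : ∀ i, relDim (W i) = r i) (hS : InShearer (depGraph E) r Finset.univ) :
    relDim (⨆ i, extend (nbr E i) (W i) : Submodule ℂ (QuditSpace d)) ≤
      1 - indepPoly (depGraph E) r := by
  classical
  -- The compared function is the relative codimension of the sum over a set of vertices.
  have := indepSum_le_of_recursion hr
    (f := fun S => 1 - relDim (⨆ i ∈ S, extend (nbr E i) (W i) : Submodule ℂ (QuditSpace d)))
    (by simp [relDim_bot]) ?_ hS
  · rw [indepSum_univ] at this
    simp only [Finset.mem_univ, iSup_pos] at this
    linarith
  intro S v hv _
  have h := relDim_sup_extend_le hd (v := v) (S := S.filter fun w => ¬ (depGraph E).Adj v w)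
    (fun w hw => ⟨by rintro rfl; exact hv (Finset.mem_filter.1 hw).1, (Finset.mem_filter.1 hw).2⟩)
    W (W v) (X := ⨆ i ∈ S, extend (nbr E i) (W i))
    (biSup_mono fun i hi => (Finset.mem_filter.1 hi).1)
  rw [hW] at h
  rw [Finset.iSup_insert, sup_comm]
  linarith

end UpperBound

/-! ### Enlarging qudits by an additional digit -/

section BlowUp

/-- The label in `Fin d'` with digits `a` and `b`. -/
def digits {d N d' : ℕ} (h : d * N ≤ d') (a : Fin d) (b : Fin N) : Fin d' :=
  ⟨a + d * b, by
    have h1 : d * b + d ≤ d * N := by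
      rw [← Nat.mul_succ]; exact Nat.mul_le_mul_left _ b.2
    have := a.2
    omega⟩

theorem digits_injective {d N d' : ℕ} (h : d * N ≤ d') {a a' : Fin d} {b b' : Fin N}
    (e : digits h a b = digits h a' b') : a = a' ∧ b = b' := by
  have e1 : (a : ℕ) + d * b = a' + d * b' := congrArg Fin.val e
  have hd : 0 < d := a.pos
  have h1 := congrArg (· % d) e1
  have h2 := congrArg (· / d) e1
  simp only [Nat.add_mul_mod_self_left, Nat.mod_eq_of_lt a.2, Nat.mod_eq_of_lt a'.2,
    Nat.add_mul_div_left _ _ hd, Nat.div_eq_of_lt a.2, Nat.div_eq_of_lt a'.2, zero_add] at h1 h2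
  exact ⟨Fin.ext h1, Fin.ext h2⟩

theorem exists_digits_eq {d N d' : ℕ} (h : d * N ≤ d') {c : Fin d'} (hc : (c : ℕ) < d * N) :
    ∃ a b, digits h a b = c := by
  have hd : 0 < d := by
    rcases Nat.eq_zero_or_pos d with rfl | hd
    · simp at hc
    · exact hd
  refine ⟨⟨c % d, Nat.mod_lt _ hd⟩, ⟨c / d, Nat.div_lt_of_lt_mul hc⟩, ?_⟩
  ext
  exact Nat.mod_add_div _ _

variable {n : ℕ} {d N d' : Fin n → ℕ}

/-- Labels of qudits of dimensions `d'` from labels of qudits of dimensions `d` and `N`. -/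
def combine (h : ∀ j, d j * N j ≤ d' j) (x : Config d) (κ : Config N) : Config d' :=
  fun j => digits (h j) (x j) (κ j)

/-- Labels of the qudits in `S` of dimensions `d'` from labels for dimensions `d` and `N`. -/
def combineOn (h : ∀ j, d j * N j ≤ d' j) (S : Finset (Fin n)) (x : Config (restrictDims d S))
    (κ : Config (restrictDims N S)) : Config (restrictDims d' S) :=
  fun j => digits (h j) (x j) (κ j)

theorem combine_injective (h : ∀ j, d j * N j ≤ d' j) {x x' : Config d} {κ κ' : Config N}
    (e : combine h x κ = combine h x' κ') : x = x' ∧ κ = κ' :=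
  ⟨funext fun j => (digits_injective (h j) (congrFun e j)).1,
    funext fun j => (digits_injective (h j) (congrFun e j)).2⟩

theorem combineOn_injective (h : ∀ j, d j * N j ≤ d' j) (S : Finset (Fin n))
    {x x' : Config (restrictDims d S)} {κ κ' : Config (restrictDims N S)}
    (e : combineOn h S x κ = combineOn h S x' κ') : x = x' ∧ κ = κ' :=
  ⟨funext fun j => (digits_injective (h j) (congrFun e j)).1,
    funext fun j => (digits_injective (h j) (congrFun e j)).2⟩

theorem finrank_sliceSpace_combineOn (h : ∀ j, d j * N j ≤ d' j) (S : Finset (Fin n))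
    (W : Config (restrictDims N S) → Submodule ℂ (QuditSpace (restrictDims d S))) :
    (Module.finrank ℂ (sliceSpace (combineOn h S) W) : ℚ) +
      ∑ κ, ((∏ j ∈ S, (d j : ℚ)) - Module.finrank ℂ (W κ)) = ∏ j ∈ S, (d' j : ℚ) := by
  have := finrank_sliceSpace (ι := combineOn h S) (fun p q e => Prod.ext
    (combineOn_injective h S e).1 (combineOn_injective h S e).2) W
  rw [card_config_restrict, card_config_restrict] at this
  push_cast at this
  exact this

/-- The sum of the blown up subspaces contains the blow-up of the sums, provided that each qudit with
labels that are not combined ones is acted upon by some subspace. -/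
theorem sliceSpace_le_iSup_extend {m : ℕ} (h : ∀ j, d j * N j ≤ d' j) (A : Fin m → Finset (Fin n))
    (hcov : ∀ j, d j * N j = d' j ∨ ∃ i, j ∈ A i)
    (W : (i : Fin m) → Config (restrictDims N (A i)) →
      Submodule ℂ (QuditSpace (restrictDims d (A i)))) :
    sliceSpace (combine h) (fun κ => ⨆ i, extend (A i) (W i (restrictConfig (A i) κ))) ≤
      ⨆ i, extend (A i) (sliceSpace (combineOn h (A i)) (W i)) := by
  classical
  intro ψ hψ
  rw [mem_sliceSpace] at hψ
  let emb (κ : Config N) : QuditSpace d →ₗ[ℂ] QuditSpace d' :=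
    { toFun := fun φ => Function.extend (fun x => combine h x κ) φ 0
      map_add' := fun φ φ' => by
        simpa using (Function.extend_add (fun x => combine h x κ) φ φ' 0 0)
      map_smul' := fun c φ => by
        simpa using (Function.extend_smul c (fun x => combine h x κ) φ 0) }
  have hinj : ∀ κ, Function.Injective fun x : Config d => combine h x κ :=
    fun κ x x' e => (combine_injective h e).1
  have emb_apply : ∀ κ φ x, emb κ φ (combine h x κ) = φ x :=
    fun κ φ x => (hinj κ).extend_apply φ (0 : Config d' → ℂ) x
  have emb_zero : ∀ κ φ y, (¬ ∃ x, combine h x κ = y) → emb κ φ y = 0 :=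
    fun κ φ y hy => Function.extend_apply' φ (0 : Config d' → ℂ) y hy
  have hinjOn : ∀ (S : Finset (Fin n)) (κ : Config (restrictDims N S)),
      Function.Injective fun x => combineOn h S x κ :=
    fun S κ x x' e => (combineOn_injective h S e).1
  -- A product vector for the dimensions `d`, placed at the fixed digits `κ` and extended by zero,
  -- is again a product vector whose factor on `A i` satisfies all slice conditions.
  have hemb : ∀ κ i, (extend (A i) (W i (restrictConfig (A i) κ))).map (emb κ) ≤
      extend (A i) (sliceSpace (combineOn h (A i)) (W i)) := by
    intro κ i
    rw [extend, Submodule.map_span, Submodule.span_le]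
    rintro _ ⟨_, ⟨φ, hφ, χ, rfl⟩, rfl⟩
    refine Submodule.subset_span ⟨Function.extend
      (fun x => combineOn h (A i) x (restrictConfig (A i) κ)) φ 0, ?_,
      Function.extend (fun x => combineOn h (A i)ᶜ x (restrictConfig (A i)ᶜ κ)) χ 0, ?_⟩
    · rw [mem_sliceSpace]
      intro κ'
      by_cases hκ : κ' = restrictConfig (A i) κ
      · subst hκ
        convert hφ using 1
        ext x
        exact (hinjOn (A i) _).extend_apply _ _ x
      · convert Submodule.zero_mem _ using 1
        ext x
        refine Function.extend_apply' _ _ _ ?_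
        rintro ⟨y, hy⟩
        exact hκ (combineOn_injective h _ hy).2.symm
    · ext x'
      by_cases hx : ∃ x, combine h x κ = x'
      · obtain ⟨x, rfl⟩ := hx
        have e1 := (hinj κ).extend_apply
          (fun x => φ (restrictConfig (A i) x) * χ (restrictConfig (A i)ᶜ x)) 0 x
        have e2 := (hinjOn (A i) (restrictConfig (A i) κ)).extend_apply φ 0 (restrictConfig (A i) x)
        have e3 := (hinjOn (A i)ᶜ (restrictConfig (A i)ᶜ κ)).extend_apply χ 0
          (restrictConfig (A i)ᶜ x)
        exact e1.trans (congrArg₂ (· * ·) e2.symm e3.symm)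
      · have e1 := Function.extend_apply' (f := fun x => combine h x κ)
          (fun x => φ (restrictConfig (A i) x) * χ (restrictConfig (A i)ᶜ x)) 0 x' hx
        refine e1.trans ?_
        by_cases h1 : ∃ a, combineOn h (A i) a (restrictConfig (A i) κ) = restrictConfig (A i) x'
        · by_cases h2 : ∃ b, combineOn h (A i)ᶜ b (restrictConfig (A i)ᶜ κ) =
            restrictConfig (A i)ᶜ x'
          · exfalso
            obtain ⟨a, ha⟩ := h1
            obtain ⟨b, hb⟩ := h2
            refine hx ⟨glue (A i) a b, ?_⟩
            funext j
            by_cases hj : j ∈ A i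
            · have := congrFun ha ⟨j, hj⟩
              simpa [combine, glue, hj, combineOn] using this
            · have := congrFun hb ⟨j, Finset.mem_compl.2 hj⟩
              simpa [combine, glue, hj, combineOn] using this
          · rw [Function.extend_apply' (f := fun x => combineOn h (A i)ᶜ x (restrictConfig (A i)ᶜ κ))
              _ _ _ h2]
            simp
        · rw [Function.extend_apply' (f := fun x => combineOn h (A i) x (restrictConfig (A i) κ))
            _ _ _ h1]
          simp
  let R : Finset (Config d') := Finset.univ.filter fun x' => ¬ ∃ x κ, combine h x κ = x'
  -- A vector is the sum of its parts at the various digits `κ` and of multiples of basis vectors at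
  -- labels that have no digits.
  have hdecomp : ψ = ∑ κ, emb κ (fun x => ψ (combine h x κ)) + ∑ x' ∈ R, ψ x' • Pi.single x' 1 := by
    ext y
    rw [Pi.add_apply, Finset.sum_apply, Finset.sum_apply]
    by_cases hy : ∃ x κ, combine h x κ = y
    · obtain ⟨x, κ, rfl⟩ := hy
      rw [Finset.sum_eq_single κ, Finset.sum_eq_zero, add_zero]
      · exact (emb_apply κ (fun x => ψ (combine h x κ)) x).symm
      · intro z hz
        have : z ≠ combine h x κ := by
          rintro rfl
          exact (Finset.mem_filter.1 hz).2 ⟨x, κ, rfl⟩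
        simp [Pi.single_eq_of_ne this.symm]
      · intro κ' _ hκ
        refine emb_zero _ _ _ ?_
        rintro ⟨x', e⟩
        exact hκ (combine_injective h e).2
      · simp
    · rw [Finset.sum_eq_zero, zero_add, Finset.sum_eq_single y]
      · simp
      · intro z _ hz
        simp [Pi.single_eq_of_ne hz.symm]
      · intro hR
        exact absurd (Finset.mem_filter.2 ⟨Finset.mem_univ y, hy⟩) hR
      · intro κ _
        refine emb_zero _ _ _ ?_
        rintro ⟨x', e⟩
        exact hy ⟨x', κ, e⟩
  rw [hdecomp]
  refine Submodule.add_mem _ (Submodule.sum_mem _ fun κ _ => ?_)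
    (Submodule.sum_mem _ fun x' hx' => Submodule.smul_mem _ _ ?_)
  · have h1 := Submodule.mem_map_of_mem (f := emb κ) (hψ κ)
    rw [Submodule.map_iSup] at h1
    exact iSup_mono (hemb κ) h1
  · have hx' := (Finset.mem_filter.1 hx').2
    have : ∃ j, ¬ ((x' j : ℕ) < d j * N j) := by
      by_contra hall
      push Not at hall
      choose a b hab using fun j => exists_digits_eq (h j) (hall j)
      exact hx' ⟨a, b, funext hab⟩
    obtain ⟨j, hj⟩ := this
    -- A basis vector whose label at `j` is a leftover one vanishes on every slice seen by a
    -- subspace acting on `j`, so it lies in that blown-up subspace for free.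
    have hne : d j * N j ≠ d' j := fun e => hj (by rw [e]; exact (x' j).2)
    obtain ⟨i, hi⟩ := (hcov j).resolve_left hne
    refine Submodule.mem_iSup_of_mem i (Submodule.subset_span
      ⟨Pi.single (restrictConfig (A i) x') 1, ?_, Pi.single (restrictConfig (A i)ᶜ x') 1, ?_⟩)
    · rw [mem_sliceSpace]
      intro κ
      convert Submodule.zero_mem _ using 1
      ext x
      refine Pi.single_eq_of_ne ?_ _
      intro e
      apply hj
      have := congrArg Fin.val (congrFun e ⟨j, hi⟩)
      change _ = (x' j : ℕ) at this
      rw [← this]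
      change (x ⟨j, hi⟩ : ℕ) + d j * (κ ⟨j, hi⟩ : ℕ) < d j * N j
      have h1 : d j * (κ ⟨j, hi⟩ : ℕ) + d j ≤ d j * N j := by
        rw [← Nat.mul_succ]; exact Nat.mul_le_mul_left _ (κ ⟨j, hi⟩).2
      have := (x ⟨j, hi⟩).2
      change (x ⟨j, hi⟩ : ℕ) < d j at this
      omega
    · ext y
      by_cases hy : y = x'
      · subst hy; simp
      · rw [Pi.single_eq_of_ne hy]
        by_cases h1 : restrictConfig (A i) y = restrictConfig (A i) x'
        · by_cases h2 : restrictConfig (A i)ᶜ y = restrictConfig (A i)ᶜ x'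
          · exact absurd (by rw [← glue_restrict (A i) y, h1, h2, glue_restrict]) hy
          · rw [Pi.single_eq_of_ne h2, mul_zero]
        · rw [Pi.single_eq_of_ne h1, zero_mul]

theorem finrank_sliceSpace_combine (h : ∀ j, d j * N j ≤ d' j)
    (X : Config N → Submodule ℂ (QuditSpace d)) :
    (Module.finrank ℂ (sliceSpace (combine h) X) : ℚ) +
      ∑ κ, ((∏ j, (d j : ℚ)) - Module.finrank ℂ (X κ)) = ∏ j, (d' j : ℚ) := by
  have := finrank_sliceSpace (ι := combine h) (fun p q e => Prod.ext
    (combine_injective h e).1 (combine_injective h e).2) X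
  rw [card_config, card_config] at this
  push_cast at this
  exact this

end BlowUp

/-! ### Splitting subspaces by relative dimension -/

section RelDim

variable {A : Type*} [Fintype A]

theorem relDim_congr {A : Type*} {W W' : Submodule ℂ (A → ℂ)}
    (h : Module.finrank ℂ W = Module.finrank ℂ W') : relDim W = relDim W' := by
  rw [relDim, relDim, h]

theorem finrank_eq_of_relDim_eq [Nonempty A] {W W' : Submodule ℂ (A → ℂ)}
    (h : relDim W = relDim W') : Module.finrank ℂ W = Module.finrank ℂ W' := by
  have hA : (Fintype.card A : ℚ) ≠ 0 := by exact_mod_cast Fintype.card_ne_zero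
  rw [relDim_eq, relDim_eq, div_left_inj' hA] at h
  exact_mod_cast h

theorem eq_bot_of_relDim [Nonempty A] {W : Submodule ℂ (A → ℂ)} (h : relDim W = 0) : W = ⊥ := by
  rw [← Submodule.finrank_eq_zero]
  simpa using finrank_eq_of_relDim_eq (h.trans relDim_bot.symm)

theorem exists_le_relDim_eq [Nonempty A] (W : Submodule ℂ (A → ℂ)) {ρ : ℚ} (h : ρ ≤ relDim W)
    (hρ : ∃ c : ℕ, ρ * Fintype.card A = c) :
    ∃ W' C, W' ⊔ C = W ∧ relDim W' = ρ ∧ relDim C = relDim W - ρ := by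
  obtain ⟨c, hc⟩ := hρ
  have hA : (0 : ℚ) < (Fintype.card A : ℚ) := by exact_mod_cast Fintype.card_pos
  have h1 : c ≤ Module.finrank ℂ W := by
    rw [relDim_eq, le_div_iff₀ hA, hc] at h
    exact_mod_cast h
  obtain ⟨W', hW', hf⟩ := exists_le_finrank_eq W h1
  obtain ⟨C, hC⟩ := IsModularLattice.exists_disjoint_and_sup_eq hW'
  have h2 : relDim W' = ρ := by
    rw [relDim_eq, hf, ← hc, mul_div_cancel_right₀ _ hA.ne']
  refine ⟨W', C, hC.2, h2, ?_⟩
  have h3 := Submodule.finrank_sup_add_finrank_inf_eq W' C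
  rw [hC.2, hC.1.eq_bot, finrank_bot, add_zero] at h3
  rw [← h2, relDim_eq, relDim_eq, relDim_eq, h3]
  push_cast
  ring

end RelDim

/-! ### Relative dimensions of blown-up and mixed subspaces -/

section Mix

variable {n : ℕ} {d N d' : Fin n → ℕ}

theorem nonempty_config {ι : Type*} {d : ι → ℕ} (hd : ∀ j, 0 < d j) : Nonempty (Config d) :=
  ⟨fun j => ⟨0, hd j⟩⟩

theorem one_sub_relDim_sliceSpace_combineOn (h : ∀ j, d j * N j ≤ d' j) (hd : ∀ j, 0 < d j)
    (hd' : ∀ j, 0 < d' j) (S : Finset (Fin n))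
    (W : Config (restrictDims N S) → Submodule ℂ (QuditSpace (restrictDims d S))) :
    1 - relDim (sliceSpace (combineOn h S) W) =
      (∑ κ, (1 - relDim (W κ))) * ((∏ j ∈ S, (d j : ℚ)) / ∏ j ∈ S, (d' j : ℚ)) := by
  have h1 := finrank_sliceSpace_combineOn h S W
  have hd0 : (0 : ℚ) < ∏ j ∈ S, (d j : ℚ) := Finset.prod_pos fun j _ => by exact_mod_cast hd j
  have hd1 : (0 : ℚ) < ∏ j ∈ S, (d' j : ℚ) := Finset.prod_pos fun j _ => by exact_mod_cast hd' j
  have h2 : ∀ κ, (1 - relDim (W κ)) * (∏ j ∈ S, (d j : ℚ)) =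
      (∏ j ∈ S, (d j : ℚ)) - Module.finrank ℂ (W κ) := by
    intro κ
    rw [relDim_eq, card_config_restrict]
    push_cast
    field_simp
  rw [mul_div_assoc', Finset.sum_mul, Finset.sum_congr rfl fun κ _ => h2 κ, relDim_eq,
    card_config_restrict]
  push_cast
  rw [eq_div_iff hd1.ne', sub_mul, div_mul_cancel₀ _ hd1.ne']
  linarith

theorem one_sub_relDim_sliceSpace_combine (h : ∀ j, d j * N j ≤ d' j) (hd : ∀ j, 0 < d j)
    (hd' : ∀ j, 0 < d' j) (X : Config N → Submodule ℂ (QuditSpace d)) :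
    1 - relDim (sliceSpace (combine h) X) =
      (∑ κ, (1 - relDim (X κ))) * ((∏ j, (d j : ℚ)) / ∏ j, (d' j : ℚ)) := by
  have h1 := finrank_sliceSpace_combine h X
  have hd0 : (0 : ℚ) < ∏ j, (d j : ℚ) := Finset.prod_pos fun j _ => by exact_mod_cast hd j
  have hd1 : (0 : ℚ) < ∏ j, (d' j : ℚ) := Finset.prod_pos fun j _ => by exact_mod_cast hd' j
  have h2 : ∀ κ, (1 - relDim (X κ)) * (∏ j, (d j : ℚ)) =
      (∏ j, (d j : ℚ)) - Module.finrank ℂ (X κ) := by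
    intro κ
    rw [relDim_eq, card_config]
    push_cast
    field_simp
  rw [mul_div_assoc', Finset.sum_mul, Finset.sum_congr rfl fun κ _ => h2 κ, relDim_eq,
    card_config]
  push_cast
  rw [eq_div_iff hd1.ne', sub_mul, div_mul_cancel₀ _ hd1.ne']
  linarith

theorem relDim_sliceSpace_combineOn (h : ∀ j, d j * N j = d' j) (hd : ∀ j, 0 < d j)
    (hN : ∀ j, 0 < N j) (S : Finset (Fin n))
    (W : Config (restrictDims N S) → Submodule ℂ (QuditSpace (restrictDims d S))) :
    relDim (sliceSpace (combineOn (fun j => (h j).le) S) W) * Fintype.card (Config (restrictDims N S)) =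
      ∑ κ, relDim (W κ) := by
  have h1 := one_sub_relDim_sliceSpace_combineOn (fun j => (h j).le) hd
    (fun j => by rw [← h j]; exact Nat.mul_pos (hd j) (hN j)) S W
  have hd0 : (0 : ℚ) < ∏ j ∈ S, (d j : ℚ) := Finset.prod_pos fun j _ => by exact_mod_cast hd j
  have hN0 : (0 : ℚ) < ∏ j ∈ S, (N j : ℚ) := Finset.prod_pos fun j _ => by exact_mod_cast hN j
  have h2 : (∏ j ∈ S, (d' j : ℚ)) = (∏ j ∈ S, (d j : ℚ)) * ∏ j ∈ S, (N j : ℚ) := by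
    rw [← Finset.prod_mul_distrib]
    refine Finset.prod_congr rfl fun j _ => ?_
    rw [← h j]; push_cast; rfl
  have h3 : (Fintype.card (Config (restrictDims N S)) : ℚ) = ∏ j ∈ S, (N j : ℚ) := by
    rw [card_config_restrict]; push_cast; rfl
  rw [h2, Finset.sum_sub_distrib, Finset.sum_const, Finset.card_univ, nsmul_eq_mul, h3] at h1
  rw [h3]
  field_simp at h1
  linarith

theorem sum_config_apply {ι : Type*} [Fintype ι] [DecidableEq ι] {N : ι → ℕ} (j : ι)
    (f : Fin (N j) → ℚ) :
    (∑ κ : Config N, f (κ j)) * N j = Fintype.card (Config N) * ∑ t, f t := by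
  have h1 : ∀ g : Fin (N j) → ℚ, ∑ κ : Config N, g (κ j) =
      Fintype.card ((i : {i // i ≠ j}) → Fin (N i)) * ∑ t, g t := by
    intro g
    rw [Fintype.sum_equiv (Equiv.piSplitAt j fun i => Fin (N i)) (fun κ => g (κ j))
      (fun p => g p.1) fun κ => rfl, Fintype.sum_prod_type]
    simp [Finset.mul_sum]
  have h2 := h1 fun _ => 1
  simp only [Finset.sum_const, Finset.card_univ, nsmul_eq_mul, mul_one, Fintype.card_fin] at h2
  rw [h1, h2]
  ring

/-- Letting the new digit at `j` choose between two subspaces averages their relative dimensions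
with weights `u / N` and `1 - u / N`. -/
theorem relDim_sliceSpace_ite (h : ∀ j, d j * N j = d' j) (hd : ∀ j, 0 < d j)
    (hN : ∀ j, 0 < N j) {S : Finset (Fin n)} {j : Fin n} (hj : j ∈ S) {u : ℕ} (hu : u ≤ N j)
    (V V' : Submodule ℂ (QuditSpace (restrictDims d S))) :
    relDim (sliceSpace (combineOn (fun j => (h j).le) S)
      fun κ => if (κ ⟨j, hj⟩ : ℕ) < u then V else V') * N j =
        u * relDim V + (N j - u) * relDim V' := by
  have h1 := relDim_sliceSpace_combineOn h hd hN S
    fun κ => if (κ ⟨j, hj⟩ : ℕ) < u then V else V'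
  have h2 := sum_config_apply (N := restrictDims N S) ⟨j, hj⟩
    fun t => if (t : ℕ) < u then relDim V else relDim V'
  have h3 : ∑ t : Fin (N j), (if (t : ℕ) < u then relDim V else relDim V') =
      u * relDim V + (N j - u) * relDim V' := by
    rw [Fin.sum_univ_eq_sum_range (fun t => if t < u then relDim V else relDim V') (N j),
      ← Finset.sum_range_add_sum_Ico _ hu, Finset.sum_congr rfl fun t ht =>
        if_pos (Finset.mem_range.1 ht), Finset.sum_congr (s₁ := Finset.Ico u (N j)) rfl fun t ht =>
        if_neg (not_lt.2 (Finset.mem_Ico.1 ht).1)]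
    simp [Nat.cast_sub hu]
  have hc : (0 : ℚ) < Fintype.card (Config (restrictDims N S)) := by
    have := nonempty_config (d := restrictDims N S) fun j => hN j
    exact_mod_cast Fintype.card_pos
  rw [← h3]
  apply mul_left_cancel₀ hc.ne'
  refine Eq.trans ?_ h2
  change _ = _ * (N j : ℚ)
  have h4 : ∑ κ : Config (restrictDims N S), (if (κ ⟨j, hj⟩ : ℕ) < u then relDim V else relDim V') =
      ∑ κ : Config (restrictDims N S), relDim (if (κ ⟨j, hj⟩ : ℕ) < u then V else V') :=
    Finset.sum_congr rfl fun κ _ => by split_ifs <;> rfl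
  rw [h4, ← h1]
  ring

theorem relDim_sliceSpace_const (h : ∀ j, d j * N j = d' j) (hd : ∀ j, 0 < d j)
    (hN : ∀ j, 0 < N j) (S : Finset (Fin n))
    (W : Submodule ℂ (QuditSpace (restrictDims d S))) :
    relDim (sliceSpace (combineOn (fun j => (h j).le) S) fun _ => W) = relDim W := by
  have h1 := relDim_sliceSpace_combineOn h hd hN S fun _ => W
  rw [Finset.sum_const, Finset.card_univ, nsmul_eq_mul] at h1
  have hc : (0 : ℚ) < Fintype.card (Config (restrictDims N S)) := by
    have := nonempty_config (d := restrictDims N S) fun j => hN j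
    exact_mod_cast Fintype.card_pos
  apply mul_left_cancel₀ hc.ne'
  rw [← h1, mul_comm]

end Mix

/-! ### Extremal subspaces -/

section Filler

variable {m n : ℕ} {E : Finset (Fin m × Fin n)}

open Classical in
/-- The subset of the vertices of `S` not adjacent to `v`. -/
noncomputable def nonAdj (E : Finset (Fin m × Fin n)) (v : Fin m) (S : Finset (Fin m)) :
    Finset (Fin m) :=
  S.filter fun w => ¬ (depGraph E).Adj v w

theorem nonAdj_subset (v : Fin m) (S : Finset (Fin m)) : nonAdj E v S ⊆ S := by
  classical
  exact Finset.filter_subset _ _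

theorem mem_nonAdj {v w : Fin m} {S : Finset (Fin m)} :
    w ∈ nonAdj E v S ↔ w ∈ S ∧ ¬ (depGraph E).Adj v w := by
  simp [nonAdj]

theorem indepSum_insert_nonAdj (r : Fin m → ℚ) {S : Finset (Fin m)} {v : Fin m} (hv : v ∉ S) :
    indepSum (depGraph E) r (insert v S) =
      indepSum (depGraph E) r S - r v * indepSum (depGraph E) r (nonAdj E v S) := by
  classical
  rw [indepSum_insert _ _ hv]
  congr 3

open Classical in
/-- The factor `N` for right vertices with a neighbour, and `1` for the other ones. -/
noncomputable def factorDims (E : Finset (Fin m × Fin n)) (N : ℕ) (j : Fin n) : ℕ :=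
  if ∃ i, j ∈ nbr E i then N else 1

theorem factorDims_of_mem {N : ℕ} {i : Fin m} {j : Fin n} (h : j ∈ nbr E i) :
    factorDims E N j = N := if_pos ⟨i, h⟩

theorem factorDims_pos {N : ℕ} (hN : 0 < N) (j : Fin n) : 0 < factorDims E N j := by
  rw [factorDims]; split_ifs <;> omega

/-- The qudit dimensions of the extremal subspaces. -/
noncomputable def tightDims (E : Finset (Fin m × Fin n)) (N k : ℕ) (j : Fin n) : ℕ :=
  factorDims E N j ^ k

theorem tightDims_pos {N : ℕ} (hN : 0 < N) (k : ℕ) (j : Fin n) : 0 < tightDims E N k j :=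
  pow_pos (factorDims_pos hN j) k

theorem tightDims_succ (N k : ℕ) (j : Fin n) :
    tightDims E N k j * factorDims E N j = tightDims E N (k + 1) j := rfl

/-- The integrality condition on `N`. -/
def Divisible (E : Finset (Fin m × Fin n)) (r : Fin m → ℚ) (N : ℕ) : Prop :=
  ∀ (S : Finset (Fin m)) (i : Fin m), i ∉ S → InShearer (depGraph E) r S →
    ∃ u : ℕ, N * (r i * indepSum (depGraph E) r (nonAdj E i S) / indepSum (depGraph E) r S) = u

variable {r : Fin m → ℚ} {N : ℕ}

theorem Divisible.exists_mul (hN : Divisible E r N) (i : Fin m) : ∃ u : ℕ, N * r i = u := by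
  obtain ⟨u, hu⟩ := hN ∅ i (by simp) fun T hT => by
    rw [Finset.subset_empty.1 hT, indepSum_empty]; exact one_pos
  refine ⟨u, ?_⟩
  have : nonAdj E i ∅ = ∅ := Finset.subset_empty.1 (nonAdj_subset i ∅)
  rw [← hu, this, indepSum_empty]
  ring

theorem Divisible.exists_mul_card (hN : Divisible E r N) (hne : ∀ i, (nbr E i).Nonempty)
    {k : ℕ} (hk : 1 ≤ k) (i : Fin m) :
    ∃ c : ℕ, r i * Fintype.card (Config (restrictDims (tightDims E N k) (nbr E i))) = c := by
  obtain ⟨u, hu⟩ := hN.exists_mul i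
  obtain ⟨j, hj⟩ := hne i
  have h1 : N ∣ ∏ j ∈ nbr E i, tightDims E N k j := by
    refine Dvd.dvd.trans ?_ (Finset.dvd_prod_of_mem _ hj)
    rw [tightDims, factorDims_of_mem hj]
    exact dvd_pow_self N (by omega)
  obtain ⟨c, hc⟩ := h1
  refine ⟨u * c, ?_⟩
  rw [card_config_restrict, hc]
  push_cast
  rw [← hu]
  ring

theorem indepSum_singleton (r : Fin m → ℚ) (i : Fin m) :
    indepSum (depGraph E) r {i} = 1 - r i := by
  have h := indepSum_insert_nonAdj (E := E) r (v := i) (S := ∅) (by simp)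
  have : nonAdj E i ∅ = ∅ := Finset.subset_empty.1 (nonAdj_subset i ∅)
  rw [this, indepSum_empty] at h
  simpa using h

/-- The property of subspaces `W` acting as prescribed on `S` to be complemented by a subspace at
`v` of the critical dimension. -/
def IsFilled (E : Finset (Fin m × Fin n)) (r : Fin m → ℚ) {d : Fin n → ℕ} (S : Finset (Fin m))
    (v : Fin m) (W : (i : Fin m) → Submodule ℂ (QuditSpace (restrictDims d (nbr E i)))) : Prop :=
  (∀ q ∈ S, relDim (W q) = r q) ∧
  relDim (W v) = indepSum (depGraph E) r S / indepSum (depGraph E) r (nonAdj E v S) ∧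
  (∀ q, q ∉ insert v S → W q = ⊥) ∧
  (⨆ i, extend (nbr E i) (W i) : Submodule ℂ (QuditSpace d)) = ⊤

/-- Without neighbours in `S`, the critical relative dimension at `v` is `1`, and the full space at
`v` fills everything. -/
theorem exists_isFilled_of_not_adj (hN0 : 0 < N) (hN : Divisible E r N)
    (hne : ∀ i, (nbr E i).Nonempty) {k : ℕ} {S : Finset (Fin m)} {v : Fin m} (hv : v ∉ S)
    (hk : S.card ≤ k) (hS : InShearer (depGraph E) r S)
    (hadj : ∀ i ∈ S, ¬ (depGraph E).Adj v i) :
    ∃ W : (i : Fin m) → Submodule ℂ (QuditSpace (restrictDims (tightDims E N k) (nbr E i))),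
      IsFilled E r S v W := by
  classical
  have hpos := tightDims_pos (E := E) hN0 k
  have hex : ∀ q ∈ S, ∃ V : Submodule ℂ (QuditSpace (restrictDims (tightDims E N k) (nbr E q))),
      relDim V = r q := by
    intro q hq
    have : Nonempty (Config (restrictDims (tightDims E N k) (nbr E q))) :=
      nonempty_config fun j => hpos j
    have h1 := hS {q} (by simpa using hq)
    rw [indepSum_singleton] at h1
    obtain ⟨V, -, -, hV, -⟩ := exists_le_relDim_eq
      (⊤ : Submodule ℂ (QuditSpace (restrictDims (tightDims E N k) (nbr E q))))
      (ρ := r q) (by rw [relDim_top]; linarith)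
      (hN.exists_mul_card hne ((Finset.card_pos.2 ⟨q, hq⟩).trans_le hk) q)
    exact ⟨V, hV⟩
  let W : (i : Fin m) → Submodule ℂ (QuditSpace (restrictDims (tightDims E N k) (nbr E i))) :=
    fun q => if hq : q ∈ S then (hex q hq).choose else if q = v then ⊤ else ⊥
  have hWv : W v = ⊤ := by simp [W, hv]
  refine ⟨W, ?_, ?_, ?_, ?_⟩
  · intro q hq
    simp only [W, dif_pos hq]
    exact (hex q hq).choose_spec
  · have : nonAdj E v S = S := by
      ext w
      rw [mem_nonAdj]
      exact ⟨fun h => h.1, fun h => ⟨h, hadj w h⟩⟩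
    have : Nonempty (Config (restrictDims (tightDims E N k) (nbr E v))) :=
      nonempty_config fun j => hpos j
    rw [hWv, relDim_top, ‹nonAdj E v S = S›, div_self (hS S subset_rfl).ne']
  · intro q hq
    rw [Finset.mem_insert, not_or] at hq
    simp [W, hq]
  · rw [eq_top_iff]
    refine le_trans ?_ (le_iSup _ v)
    rw [hWv, extend_top]

/-- For a neighbour `i ∈ S` of `v`, let `S' = S \ i`. The fillings for `S'` completed at `v` and at
`i` are mixed with weights `1 - u/N` and `u/N`. The weight is chosen so that `i` gets relative
dimension `r i`; since `I(S) = (1 - u/N) I(S')`, the vertex `v` then gets the critical one. Each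
induction step multiplies the dimensions by `N`. -/
theorem exists_isFilled (hN0 : 0 < N) (hN : Divisible E r N)
    (hne : ∀ i, (nbr E i).Nonempty) (k : ℕ) : ∀ (S : Finset (Fin m)) (v : Fin m), v ∉ S →
    S.card ≤ k → InShearer (depGraph E) r S →
    ∃ W : (i : Fin m) → Submodule ℂ (QuditSpace (restrictDims (tightDims E N k) (nbr E i))),
      IsFilled E r S v W := by
  classical
  induction k with
  | zero =>
    intro S v hv hk hS
    have : S = ∅ := by simpa using hk
    subst this
    exact exists_isFilled_of_not_adj hN0 hN hne hv hk hS (by simp)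
  | succ k ih =>
    intro S v hv hk hS
    by_cases hadj : ∀ i ∈ S, ¬ (depGraph E).Adj v i
    · exact exists_isFilled_of_not_adj hN0 hN hne hv hk hS hadj
    push Not at hadj
    obtain ⟨i, hi, hvi⟩ := hadj
    have hiv : i ≠ v := by rintro rfl; exact hv hi
    have hiS' : i ∉ S.erase i := Finset.notMem_erase i S
    have hSi : insert i (S.erase i) = S := Finset.insert_erase hi
    have hcard : (S.erase i).card ≤ k := by rw [Finset.card_erase_of_mem hi]; omega
    have hS' : InShearer (depGraph E) r (S.erase i) := hS.mono (Finset.erase_subset i S)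
    have hpos := tightDims_pos (E := E) hN0 k
    have hpos' := tightDims_pos (E := E) hN0 (k + 1)
    have hfac := factorDims_pos (E := E) hN0
    have hnon : ∀ k (S : Finset (Fin n)), Nonempty (Config (restrictDims (tightDims E N k) S)) :=
      fun k S => nonempty_config fun j => tightDims_pos (E := E) hN0 k j.1
    have hnon' : ∀ k, Nonempty (Config (tightDims E N k)) :=
      fun k => nonempty_config fun j => tightDims_pos (E := E) hN0 k j
    obtain ⟨W₁, hW₁, hW₁v, hW₁b, hW₁t⟩ := ih (S.erase i) v
      (fun h => hv (Finset.mem_of_mem_erase h)) hcard hS'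
    obtain ⟨W₂, hW₂, hW₂i, hW₂b, hW₂t⟩ := ih (S.erase i) i hiS' hcard hS'
    -- Both fillings are made to agree on `S.erase i`. Maximality of the sums survives because they
    -- were the whole space.
    obtain ⟨V₁, V₂, hV₁, hV₂, hV, hV₁t, hV₂t⟩ := exists_common_subspaces (nbr E)
      (tightDims E N k) (S.erase i) W₁ W₂
      fun q hq => finrank_eq_of_relDim_eq ((hW₁ q hq).trans (hW₂ q hq).symm)
    rw [hW₁t, finrank_top] at hV₁t
    rw [hW₂t, finrank_top] at hV₂t
    have hV₁top := Submodule.eq_top_of_finrank_eq ((Submodule.finrank_le _).antisymm hV₁t)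
    have hV₂top := Submodule.eq_top_of_finrank_eq ((Submodule.finrank_le _).antisymm hV₂t)
    have hV₁b : ∀ q, q ∉ insert v (S.erase i) → V₁ q = ⊥ := fun q hq =>
      Submodule.finrank_eq_zero.1 ((hV₁ q).trans (by rw [hW₁b q hq, finrank_bot]))
    have hV₂b : ∀ q, q ∉ insert i (S.erase i) → V₂ q = ⊥ := fun q hq =>
      Submodule.finrank_eq_zero.1 ((hV₂ q).trans (by rw [hW₂b q hq, finrank_bot]))
    obtain ⟨j, hj⟩ := hvi.2
    obtain ⟨hjv, hji⟩ := Finset.mem_inter.1 hj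
    -- Integrality of `u`, the number of digits assigned to the filling completed at `i`, is what
    -- `Divisible` is for.
    obtain ⟨u, hu⟩ := hN (S.erase i) i hiS' hS'
    have hI' := hS' _ subset_rfl
    have hI := hS _ subset_rfl
    have hIi := hS' _ (nonAdj_subset (E := E) i (S.erase i))
    have hrec := indepSum_insert_nonAdj (E := E) r hiS'
    rw [hSi] at hrec
    have hN0' : (0 : ℚ) < N := by exact_mod_cast hN0
    have huN : u ≤ N := by
      have : (u : ℚ) ≤ N := by
        rw [← hu]
        refine mul_le_of_le_one_right hN0'.le ?_
        rw [div_le_one hI']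
        linarith
      exact_mod_cast this
    -- The fillings differ at most at `i` and `v`, and both of these act on qudit `j`. So every
    -- subspace that has to switch between them can read the digit at `j`.
    have hVeq : ∀ q, j ∉ nbr E q → V₁ q = V₂ q := by
      intro q hq
      by_cases hqS : q ∈ S.erase i
      · exact hV q hqS
      · rw [hV₁b, hV₂b]
        · rw [Finset.mem_insert, not_or]
          exact ⟨by rintro rfl; exact hq hji, hqS⟩
        · rw [Finset.mem_insert, not_or]
          exact ⟨by rintro rfl; exact hq hjv, hqS⟩
    let Wκ (q : Fin m) (κ : Config (restrictDims (factorDims E N) (nbr E q))) :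
        Submodule ℂ (QuditSpace (restrictDims (tightDims E N k) (nbr E q))) :=
      if hq : j ∈ nbr E q then if (κ ⟨j, hq⟩ : ℕ) < u then V₂ q else V₁ q else V₁ q
    have hstep : ∀ j, tightDims E N k j * factorDims E N j = tightDims E N (k + 1) j :=
      tightDims_succ N k
    have hconst : ∀ q, V₁ q = V₂ q → relDim (sliceSpace
        (combineOn (fun j => (hstep j).le) (nbr E q)) (Wκ q)) = relDim (V₁ q) := by
      intro q hq
      have : Wκ q = fun _ => V₁ q := by
        funext κ
        simp only [Wκ]
        split_ifs <;> simp [hq]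
      rw [this]
      exact relDim_sliceSpace_const hstep hpos hfac _ _
    have hmix : ∀ q, j ∈ nbr E q → relDim (sliceSpace
        (combineOn (fun j => (hstep j).le) (nbr E q)) (Wκ q)) * N =
          u * relDim (V₂ q) + (N - u) * relDim (V₁ q) := by
      intro q hq
      have : Wκ q = fun κ => if (κ ⟨j, hq⟩ : ℕ) < u then V₂ q else V₁ q := by
        funext κ
        simp only [Wκ, dif_pos hq]
      have h1 := relDim_sliceSpace_ite hstep hpos hfac hq (u := u)
        (by rw [factorDims_of_mem hq]; exact huN) (V₂ q) (V₁ q)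
      rw [factorDims_of_mem hq] at h1
      rw [this]
      exact h1
    refine ⟨fun q => sliceSpace (combineOn (fun j => (hstep j).le) (nbr E q)) (Wκ q),
      ?_, ?_, ?_, ?_⟩
    · intro q hq
      by_cases hqi : q = i
      · subst hqi
        have h1 := hmix q hji
        have hvq : q ∉ insert v (S.erase q) := by simp [hiv]
        rw [hV₁b q hvq, relDim_bot, mul_zero, add_zero, relDim_congr (hV₂ q), hW₂i, ← hu] at h1
        apply mul_right_cancel₀ hN0'.ne'
        rw [h1]
        field_simp
      · have hq' := Finset.mem_erase.2 ⟨hqi, hq⟩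
        rw [hconst q (hV q hq'), relDim_congr (hV₁ q), hW₁ q hq']
    · have h1 := hmix v hjv
      have hvq : v ∉ insert i (S.erase i) := by rw [hSi]; exact hv
      -- Removing `i` does not change the nonneighbours of `v`, as `i` is adjacent to `v`; the two
      -- denominators therefore agree.
      have hnonadj : nonAdj E v (S.erase i) = nonAdj E v S := by
        ext w
        rw [mem_nonAdj, mem_nonAdj, Finset.mem_erase]
        constructor
        · exact fun h => ⟨h.1.2, h.2⟩
        · exact fun h => ⟨⟨by rintro rfl; exact h.2 hvi, h.1⟩, h.2⟩
      have hIv := hS _ (nonAdj_subset (E := E) v S)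
      rw [hV₂b v hvq, relDim_bot, mul_zero, zero_add, relDim_congr (hV₁ v), hW₁v, ← hu,
        hnonadj] at h1
      apply mul_right_cancel₀ hN0'.ne'
      rw [h1, hrec]
      field_simp
    · intro q hq
      have hq1 : q ∉ insert v (S.erase i) := by
        simp only [Finset.mem_insert, Finset.mem_erase, not_or, not_and] at hq ⊢
        exact ⟨hq.1, fun _ => hq.2⟩
      have hq2 : q ∉ insert i (S.erase i) := by
        rw [hSi]
        exact fun h => hq (Finset.mem_insert_of_mem h)
      apply eq_bot_of_relDim
      rw [hconst q ((hV₁b q hq1).trans (hV₂b q hq2).symm), hV₁b q hq1, relDim_bot]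
    · have hle := sliceSpace_le_iSup_extend (fun j => (hstep j).le) (nbr E)
        (fun j => Or.inl (hstep j)) Wκ
      rw [eq_top_iff]
      refine le_trans (fun ψ _ => mem_sliceSpace.2 fun κ => ?_) hle
      have htop : (⨆ q, extend (nbr E q) (Wκ q (restrictConfig (nbr E q) κ)) :
          Submodule ℂ (QuditSpace (tightDims E N k))) = ⊤ := by
        by_cases hκ : (κ j : ℕ) < u
        · rw [← hV₂top]
          refine iSup_congr fun q => congrArg _ ?_
          simp only [Wκ]
          split_ifs with h1
          · rfl
          · exact hVeq q h1
        · rw [← hV₁top]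
          refine iSup_congr fun q => congrArg _ ?_
          simp only [Wκ]
          split_ifs with h1
          · rfl
          · rfl
      rw [htop]
      trivial

/-- Fill the space at `v` over `T = S \ v`, then discard a part `C` of the subspace at `v` to come
down to `r v`. The part has relative dimension `I(T)/I(R) - r_v = I(S)/I(R)`, where `R` consists of
the nonneighbours of `v` in `T`. If the sum over `R` has codimension at most `I(R)`, then by
`relDim_sup_extend_le` discarding `C` costs at most `I(S)`. -/
theorem exists_relDim_iSup_ge (hN0 : 0 < N) (hN : Divisible E r N)
    (hne : ∀ i, (nbr E i).Nonempty) {k : ℕ} (S : Finset (Fin m)) (hk : S.card ≤ k)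
    (hS : InShearer (depGraph E) r S) :
    ∃ W : (i : Fin m) → Submodule ℂ (QuditSpace (restrictDims (tightDims E N k) (nbr E i))),
      (∀ q ∈ S, relDim (W q) = r q) ∧ (∀ q ∉ S, W q = ⊥) ∧
      1 - indepSum (depGraph E) r S ≤
        relDim (⨆ i, extend (nbr E i) (W i) : Submodule ℂ (QuditSpace (tightDims E N k))) := by
  classical
  induction S using Finset.strongInduction with
  | H S ih =>
    rcases S.eq_empty_or_nonempty with rfl | ⟨v, hv⟩
    · refine ⟨fun _ => ⊥, by simp, by simp, ?_⟩
      rw [indepSum_empty, sub_self]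
      exact relDim_nonneg _
    have hnon : ∀ (S : Finset (Fin n)), Nonempty (Config (restrictDims (tightDims E N k) S)) :=
      fun S => nonempty_config fun j => tightDims_pos (E := E) hN0 k j.1
    have hnon' : Nonempty (Config (tightDims E N k)) :=
      nonempty_config fun j => tightDims_pos (E := E) hN0 k j
    have hSv : insert v (S.erase v) = S := Finset.insert_erase hv
    have hsub : S.erase v ⊆ S := Finset.erase_subset v S
    have hvT : v ∉ S.erase v := Finset.notMem_erase v S
    have hRT := nonAdj_subset (E := E) v (S.erase v)
    have hvR : v ∉ nonAdj E v (S.erase v) := fun h => hvT (hRT h)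
    have hT := hS.mono hsub
    obtain ⟨W₁, hW₁, hW₁v, hW₁b, hW₁t⟩ := exists_isFilled hN0 hN hne k (S.erase v) v hvT
      ((Finset.card_le_card hsub).trans hk) hT
    obtain ⟨W₃, hW₃, hW₃b, hW₃r⟩ := ih (nonAdj E v (S.erase v))
      (hRT.trans_ssubset (Finset.erase_ssubset hv))
      ((Finset.card_le_card (hRT.trans hsub)).trans hk) (hT.mono hRT)
    -- The filling and the extremal example for `R` are made to agree on `R`, so that the filling
    -- also has a large sum over `R`.
    obtain ⟨V₁, V₃, hV₁, hV₃, hV, hV₁t, hV₃t⟩ := exists_common_subspaces (nbr E)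
      (tightDims E N k) (nonAdj E v (S.erase v)) W₁ W₃
      fun q hq => finrank_eq_of_relDim_eq ((hW₁ q (hRT hq)).trans (hW₃ q hq).symm)
    rw [hW₁t, finrank_top] at hV₁t
    have hV₁top := Submodule.eq_top_of_finrank_eq ((Submodule.finrank_le _).antisymm hV₁t)
    have hV₃b : ∀ q, q ∉ nonAdj E v (S.erase v) → V₃ q = ⊥ := fun q hq =>
      Submodule.finrank_eq_zero.1 ((hV₃ q).trans (by rw [hW₃b q hq, finrank_bot]))
    have hV₁b : ∀ q, q ∉ insert v (S.erase v) → V₁ q = ⊥ := fun q hq =>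
      Submodule.finrank_eq_zero.1 ((hV₁ q).trans (by rw [hW₁b q hq, finrank_bot]))
    have hI := hS _ subset_rfl
    have hIT := hT _ subset_rfl
    have hIR := hT _ hRT
    have hrec := indepSum_insert_nonAdj (E := E) r hvT
    rw [hSv] at hrec
    have hV₁v : relDim (V₁ v) = indepSum (depGraph E) r (S.erase v) /
        indepSum (depGraph E) r (nonAdj E v (S.erase v)) := (relDim_congr (hV₁ v)).trans hW₁v
    obtain ⟨U, C, hUC, hU, hC⟩ := exists_le_relDim_eq (V₁ v) (ρ := r v)
      (by rw [hV₁v, le_div_iff₀ hIR]; linarith)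
      (hN.exists_mul_card hne ((Finset.card_pos.2 ⟨v, hv⟩).trans_le hk) v)
    refine ⟨Function.update V₁ v U, ?_, ?_, ?_⟩
    · intro q hq
      by_cases hqv : q = v
      · subst hqv
        rw [Function.update_self, hU]
      · rw [Function.update_of_ne hqv, relDim_congr (hV₁ q), hW₁ q (Finset.mem_erase.2 ⟨hqv, hq⟩)]
    · intro q hq
      have hqv : q ≠ v := by rintro rfl; exact hq hv
      rw [Function.update_of_ne hqv, hV₁b q (by rwa [hSv])]
    · have hX : ⨆ i ∈ nonAdj E v (S.erase v), extend (nbr E i) (V₁ i) ≤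
          (⨆ i, extend (nbr E i) (Function.update V₁ v U i) :
            Submodule ℂ (QuditSpace (tightDims E N k))) := by
        refine iSup₂_le fun i hi => ?_
        have hiv : i ≠ v := by rintro rfl; exact hvR hi
        refine le_trans ?_ (le_iSup _ i)
        rw [Function.update_of_ne hiv]
      have hmain := relDim_sup_extend_le (E := E) (d := tightDims E N k) (tightDims_pos hN0 k)
        (v := v) (S := nonAdj E v (S.erase v))
        (fun w hw => ⟨by rintro rfl; exact hvR hw, (mem_nonAdj.1 hw).2⟩) V₁ C hX
      have htop : (⨆ i, extend (nbr E i) (Function.update V₁ v U i) :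
            Submodule ℂ (QuditSpace (tightDims E N k))) ⊔ extend (nbr E v) C = ⊤ := by
        rw [eq_top_iff, ← hV₁top]
        refine iSup_le fun i => ?_
        by_cases hiv : i = v
        · subst hiv
          rw [← hUC, extend_sup]
          refine sup_le_sup_right ?_ _
          refine le_trans ?_ (le_iSup _ i)
          rw [Function.update_self]
        · refine le_sup_of_le_left (le_trans ?_ (le_iSup _ i))
          rw [Function.update_of_ne hiv]
      have hR : (⨆ i, extend (nbr E i) (V₃ i) : Submodule ℂ (QuditSpace (tightDims E N k))) =
          ⨆ i ∈ nonAdj E v (S.erase v), extend (nbr E i) (V₁ i) := by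
        refine iSup_congr fun i => ?_
        by_cases hi : i ∈ nonAdj E v (S.erase v)
        · simp [hi, hV i hi]
        · simp [hi, hV₃b i hi]
      have h3 := hW₃r.trans (relDim_le_of_finrank_le hV₃t)
      rw [hR] at h3
      rw [htop, relDim_top, hC, hV₁v] at hmain
      have hρ : 0 ≤ indepSum (depGraph E) r (S.erase v) /
          indepSum (depGraph E) r (nonAdj E v (S.erase v)) - r v := by
        rw [sub_nonneg, le_div_iff₀ hIR]
        linarith
      have h4 := mul_le_mul_of_nonneg_left (sub_le_comm.1 h3) hρ
      have h5 : (indepSum (depGraph E) r (S.erase v) /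
          indepSum (depGraph E) r (nonAdj E v (S.erase v)) - r v) *
          indepSum (depGraph E) r (nonAdj E v (S.erase v)) = indepSum (depGraph E) r S := by
        rw [hrec, sub_mul, div_mul_cancel₀ _ hIR.ne']
      linarith

/-- In a minimal set `S` with `I(S) ≤ 0`, any vertex `v` has critical relative dimension `I(S \ v) /
I(R)` at most `r v`, with `R` the nonneighbours of `v` in `S \ v`. So the filling at `v` over `S \
v` is affordable. -/
theorem exists_iSup_eq_top (hr : ∀ i, 0 ≤ r i) (hN0 : 0 < N) (hN : Divisible E r N)
    (hne : ∀ i, (nbr E i).Nonempty) (hS : ¬ InShearer (depGraph E) r Finset.univ) :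
    ∃ W : (i : Fin m) → Submodule ℂ (QuditSpace (restrictDims (tightDims E N m) (nbr E i))),
      (∀ q, relDim (W q) ≤ r q) ∧
      (⨆ i, extend (nbr E i) (W i) : Submodule ℂ (QuditSpace (tightDims E N m))) = ⊤ := by
  classical
  have hex : ∃ S : Finset (Fin m), indepSum (depGraph E) r S ≤ 0 := by
    by_contra h
    push Not at h
    exact hS fun T _ => h T
  obtain ⟨S, hS, hmin⟩ := WellFounded.has_min (wellFounded_lt (α := Finset (Fin m)))
    {S | indepSum (depGraph E) r S ≤ 0} hex
  change indepSum (depGraph E) r S ≤ 0 at hS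
  have hne' : S.Nonempty := by
    rw [Finset.nonempty_iff_ne_empty]
    rintro rfl
    rw [indepSum_empty] at hS
    linarith
  obtain ⟨v, hv⟩ := hne'
  have hSv : insert v (S.erase v) = S := Finset.insert_erase hv
  have hvT : v ∉ S.erase v := Finset.notMem_erase v S
  have hT : InShearer (depGraph E) r (S.erase v) := by
    intro T hT
    by_contra h
    exact hmin T (not_lt.1 h) (lt_of_le_of_lt hT (Finset.erase_ssubset hv))
  obtain ⟨W, hW, hWv, hWb, hWt⟩ := exists_isFilled hN0 hN hne m (S.erase v) v hvT
    ((Finset.card_le_univ _).trans_eq (Fintype.card_fin m)) hT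
  refine ⟨W, fun q => ?_, hWt⟩
  by_cases hqv : q = v
  · subst hqv
    have hIR := hT _ (nonAdj_subset (E := E) q (S.erase q))
    have hrec := indepSum_insert_nonAdj (E := E) r hvT
    rw [hSv] at hrec
    rw [hWv, div_le_iff₀ hIR]
    linarith
  · by_cases hq : q ∈ S.erase v
    · exact (hW q hq).le
    · rw [hWb q (by simp only [Finset.mem_insert, not_or]; exact ⟨hqv, hq⟩), relDim_bot]
      exact hr q

end Filler

/-! ### Rounding, and passage to arbitrary large dimensions -/

section Approximation

variable {m n : ℕ} {E : Finset (Fin m × Fin n)}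

/-- The number `q ^ m * I(S)` is an integer, and in Shearer's bound it lies between `1` and `q ^ m`.
Multiplying `q` by all these integers clears every denominator `I(S)`; the exponent counts `2 ^ m`
factors of size at most `q ^ m`. -/
theorem exists_divisible {r : Fin m → ℚ} (hr : ∀ i, 0 ≤ r i) {q : ℕ} (hq : 0 < q)
    (hint : ∀ i, ∃ p : ℤ, q * r i = p) :
    ∃ N : ℕ, 0 < N ∧ N ≤ q ^ (1 + m * 2 ^ m) ∧ Divisible E r N := by
  classical
  have hq0 : (0 : ℚ) < q := by exact_mod_cast hq
  have hex : ∀ S : Finset (Fin m), ∃ c : ℕ, 0 < c ∧ c ≤ q ^ m ∧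
      (InShearer (depGraph E) r S → (q : ℚ) ^ m * indepSum (depGraph E) r S = c) := by
    intro S
    by_cases hS : InShearer (depGraph E) r S
    · obtain ⟨p, hp⟩ := exists_int_pow_mul_indepSum (H := depGraph E) hint S (k := m)
        ((Finset.card_le_univ S).trans_eq (Fintype.card_fin m))
      have hpos : 0 < (q : ℚ) ^ m * indepSum (depGraph E) r S :=
        mul_pos (pow_pos hq0 m) (hS S subset_rfl)
      have hle : (q : ℚ) ^ m * indepSum (depGraph E) r S ≤ (q : ℚ) ^ m :=
        mul_le_of_le_one_right (pow_pos hq0 m).le (indepSum_le_one hr hS)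
      rw [hp] at hpos hle
      have hp0 : 0 < p := by exact_mod_cast hpos
      have hp1 : p ≤ ((q ^ m : ℕ) : ℤ) := by exact_mod_cast hle
      lift p to ℕ using hp0.le
      exact ⟨p, by exact_mod_cast hp0, by exact_mod_cast hp1, fun _ => by rw [hp]; simp⟩
    · exact ⟨1, one_pos, Nat.one_le_pow _ _ hq, fun h => absurd h hS⟩
  choose c hc0 hcq hc using hex
  refine ⟨q * ∏ S : Finset (Fin m), c S, Nat.mul_pos hq (Finset.prod_pos fun S _ => hc0 S), ?_, ?_⟩
  · rw [pow_add, pow_one, pow_mul]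
    refine Nat.mul_le_mul_left _ ?_
    refine (Finset.prod_le_pow_card _ _ _ fun S _ => hcq S).trans_eq ?_
    rw [Finset.card_univ, Fintype.card_finset, Fintype.card_fin]
  · intro S i _ hS
    obtain ⟨p, hp⟩ := hint i
    have hp0 : 0 ≤ p := by
      have : (0 : ℚ) ≤ p := by rw [← hp]; exact mul_nonneg hq0.le (hr i)
      exact_mod_cast this
    lift p to ℕ using hp0
    refine ⟨p * c (nonAdj E i S) * ∏ T ∈ Finset.univ.erase S, c T, ?_⟩
    have h1 := hc S hS
    have h2 := hc _ (hS.mono (nonAdj_subset (E := E) i S))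
    have hI := hS S subset_rfl
    rw [← Finset.mul_prod_erase Finset.univ c (Finset.mem_univ S)]
    push_cast
    rw [← h1, ← h2]
    have hp' : (q : ℚ) * r i = (p : ℚ) := by rw [hp]; simp
    rw [← hp']
    field_simp

theorem one_sub_le_prod {ι : Type*} (S : Finset ι) {a : ι → ℝ} (h0 : ∀ j, 0 ≤ a j)
    (h1 : ∀ j, a j ≤ 1) : 1 - ∑ j ∈ S, (1 - a j) ≤ ∏ j ∈ S, a j := by
  classical
  induction S using Finset.induction_on with
  | empty => simp
  | insert j S hj ih =>
    rw [Finset.sum_insert hj, Finset.prod_insert hj]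
    have h2 : ∏ j ∈ S, a j ≤ 1 := Finset.prod_le_one (fun j _ => h0 j) fun j _ => h1 j
    nlinarith [h0 j, h1 j]

/-- Subspaces for the dimensions `d₀` give subspaces for all large dimensions `d`, with slightly
larger relative dimensions. -/
theorem exists_subspaces_of_le {d₀ d : Fin n → ℕ} (hd₀ : ∀ j, 0 < d₀ j) (hd : ∀ j, 0 < d j)
    (hcov : ∀ j, d₀ j = 1 ∨ ∃ i, j ∈ nbr E i) {δ : ℝ} (hδ : 0 ≤ δ)
    (hdδ : ∀ j, (n : ℝ) * d₀ j ≤ δ * d j)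
    (W₀ : (i : Fin m) → Submodule ℂ (QuditSpace (restrictDims d₀ (nbr E i)))) :
    ∃ W : (i : Fin m) → Submodule ℂ (QuditSpace (restrictDims d (nbr E i))),
      (∀ i, (relDim (W i) : ℝ) ≤ relDim (W₀ i) + δ) ∧
      relDim (⨆ i, extend (nbr E i) (W₀ i) : Submodule ℂ (QuditSpace d₀)) ≤
        relDim (⨆ i, extend (nbr E i) (W i) : Submodule ℂ (QuditSpace d)) := by
  -- Each qudit is cut into as many blocks of size `d₀ j` as fit. The fewer than `d₀ j` leftover
  -- labels are given to all subspaces acting on the qudit, so relative codimensions shrink by a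
  -- factor between `1 - δ` and `1`.
  let N : Fin n → ℕ := fun j => d j / d₀ j
  have h : ∀ j, d₀ j * N j ≤ d j := fun j => Nat.mul_div_le _ _
  have hd1 : ∀ j, (0 : ℝ) < d j := fun j => by exact_mod_cast hd j
  have hratio0 : ∀ j, (0 : ℝ) ≤ d₀ j * N j / d j := fun j => by positivity
  have hratio1 : ∀ j, (d₀ j * N j / d j : ℝ) ≤ 1 := fun j => by
    rw [div_le_one (hd1 j)]
    exact_mod_cast h j
  have hratio : ∀ j, 1 - (d₀ j * N j / d j : ℝ) ≤ δ / n := by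
    intro j
    have hn : (0 : ℝ) < n := by exact_mod_cast j.pos
    have h2 : (d j : ℝ) - d₀ j * N j ≤ d₀ j := by
      have h3 : d j ≤ d₀ j * N j + d₀ j := by
        have := Nat.mod_add_div (d j) (d₀ j)
        have := Nat.mod_lt (d j) (hd₀ j)
        change d j ≤ d₀ j * (d j / d₀ j) + d₀ j
        omega
      have : (d j : ℝ) ≤ d₀ j * N j + d₀ j := by exact_mod_cast h3
      linarith
    rw [one_sub_div (hd1 j).ne', div_le_div_iff₀ (hd1 j) hn]
    nlinarith [hdδ j]
  have hcard : ∀ S : Finset (Fin n), 1 - δ ≤ ∏ j ∈ S, (d₀ j * N j / d j : ℝ) := by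
    intro S
    refine le_trans ?_ (one_sub_le_prod S hratio0 hratio1)
    have h2 : ∑ j ∈ S, (1 - (d₀ j * N j / d j : ℝ)) ≤ δ := by
      rcases S.eq_empty_or_nonempty with rfl | ⟨j, _⟩
      · simpa using hδ
      have hn : (0 : ℝ) < n := by exact_mod_cast j.pos
      calc _ ≤ ∑ j ∈ S, δ / n := Finset.sum_le_sum fun j _ => hratio j
        _ = S.card * (δ / n) := by rw [Finset.sum_const, nsmul_eq_mul]
        _ ≤ n * (δ / n) := by
            gcongr
            exact_mod_cast (Finset.card_le_univ S).trans_eq (Fintype.card_fin n)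
        _ = δ := by field_simp
    linarith
  refine ⟨fun i => sliceSpace (combineOn h (nbr E i)) fun _ => W₀ i, fun i => ?_, ?_⟩
  · have h2 := one_sub_relDim_sliceSpace_combineOn h hd₀ hd (nbr E i) fun _ => W₀ i
    rw [Finset.sum_const, Finset.card_univ, card_config_restrict, nsmul_eq_mul] at h2
    have h3 : ((1 - relDim (sliceSpace (combineOn h (nbr E i)) fun _ => W₀ i) : ℚ) : ℝ) =
        (1 - relDim (W₀ i)) * ∏ j ∈ nbr E i, (d₀ j * N j / d j : ℝ) := by
      rw [h2, Finset.prod_div_distrib, Finset.prod_mul_distrib]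
      push_cast
      ring
    push_cast at h3
    have h4 : (0 : ℝ) ≤ relDim (W₀ i) := by exact_mod_cast relDim_nonneg (W₀ i)
    have h5 : (relDim (W₀ i) : ℝ) ≤ 1 := by exact_mod_cast relDim_le_one (W₀ i)
    have h6 := mul_le_mul_of_nonneg_left (hcard (nbr E i)) (sub_nonneg.2 h5)
    have h7 := mul_nonneg h4 hδ
    linarith
  · have hle := sliceSpace_le_iSup_extend h (nbr E) (fun j => (hcov j).imp_left fun hj => by
      simp [N, hj]) fun i _ => W₀ i
    refine le_trans ?_ (relDim_mono hle)
    have h2 := one_sub_relDim_sliceSpace_combine h hd₀ hd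
      fun _ => (⨆ i, extend (nbr E i) (W₀ i) : Submodule ℂ (QuditSpace d₀))
    rw [Finset.sum_const, Finset.card_univ, card_config, nsmul_eq_mul] at h2
    have h3 : ((∏ j, N j : ℕ) : ℚ) * ((∏ j, (d₀ j : ℚ)) / ∏ j, (d j : ℚ)) ≤ 1 := by
      rw [mul_div_assoc', div_le_one (Finset.prod_pos fun j _ => by exact_mod_cast hd j)]
      push_cast
      rw [← Finset.prod_mul_distrib]
      refine Finset.prod_le_prod (fun j _ => by positivity) fun j _ => ?_
      rw [mul_comm]
      exact_mod_cast h j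
    have h4 := relDim_le_one (⨆ i, extend (nbr E i) (W₀ i) : Submodule ℂ (QuditSpace d₀))
    have h5 := mul_le_mul_of_nonneg_left h3 (sub_nonneg.2 h4)
    linarith

theorem pow_bound {q : ℕ} (hq : 0 < q) {N : ℕ} (hN : N ≤ q ^ (1 + m * 2 ^ m)) :
    N ^ m ≤ q ^ (m * 2 ^ (2 * m)) := by
  refine (Nat.pow_le_pow_left hN m).trans ?_
  rw [← pow_mul]
  refine Nat.pow_le_pow_right hq ?_
  rw [mul_comm]
  refine Nat.mul_le_mul_left m ?_
  have h1 : m + 1 ≤ 2 ^ m := Nat.lt_two_pow_self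
  have h2 : 1 ≤ 2 ^ m := Nat.one_le_two_pow
  calc 1 + m * 2 ^ m ≤ 2 ^ m + m * 2 ^ m := by omega
    _ = (m + 1) * 2 ^ m := by ring
    _ ≤ 2 ^ m * 2 ^ m := Nat.mul_le_mul_right _ h1
    _ = 2 ^ (2 * m) := by rw [← pow_add]; congr 1; ring

/-- In large dimensions there are subspaces, with relative dimensions slightly larger than `r`,
whose sum is as large as Shearer's bound permits. -/
theorem exists_almost_tight (hm : 0 < m) (hne : ∀ i, (nbr E i).Nonempty) {ε : ℝ} (hε : 0 < ε)
    {d : Fin n → ℕ} (hd : ∀ j, 0 < d j)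
    (hdD : ∀ j, ⌈2 * (⌈2 * (m : ℝ) / ε⌉₊ : ℝ) ^ (m * 2 ^ (2 * m)) * (m : ℝ) * (n : ℝ) / ε⌉₊ ≤ d j)
    {r : Fin m → ℚ} (hr : ∀ i, 0 ≤ r i) :
    ∃ W : (i : Fin m) → Submodule ℂ (QuditSpace (restrictDims d (nbr E i))),
      (∀ i, (relDim (W i) : ℝ) ≤ r i + ε / m) ∧
      (BeyondShearer (depGraph E) r →
        relDim (⨆ i, extend (nbr E i) (W i) : Submodule ℂ (QuditSpace d)) = 1) ∧
      (¬ BeyondShearer (depGraph E) r → 1 - indepPoly (depGraph E) r ≤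
        relDim (⨆ i, extend (nbr E i) (W i) : Submodule ℂ (QuditSpace d))) := by
  have hm0 : (0 : ℝ) < m := by exact_mod_cast hm
  set q := ⌈2 * (m : ℝ) / ε⌉₊ with hqdef
  have hq : 0 < q := Nat.ceil_pos.2 (by positivity)
  have hq0 : (0 : ℚ) < q := by exact_mod_cast hq
  have hq1 : (0 : ℝ) < q := by exact_mod_cast hq
  have hqε : 2 * (m : ℝ) / ε ≤ q := Nat.le_ceil _
  -- Rounding up to a multiple of `1/q` adds at most `1/q ≤ ε/(2m)`, half of the permitted excess.
  let s : Fin m → ℚ := fun i => (⌈q * r i⌉ : ℚ) / q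
  have hrs : ∀ i, r i ≤ s i := fun i => by
    rw [le_div_iff₀ hq0, mul_comm]
    exact Int.le_ceil _
  have hs : ∀ i, 0 ≤ s i := fun i => (hr i).trans (hrs i)
  have hsr : ∀ i, (s i : ℝ) ≤ r i + ε / (2 * m) := fun i => by
    have h1 : s i ≤ r i + 1 / q := by
      rw [div_le_iff₀ hq0, add_mul, one_div, inv_mul_cancel₀ hq0.ne', mul_comm]
      exact (Int.ceil_lt_add_one _).le
    have h2 : (1 : ℝ) / q ≤ ε / (2 * m) := by
      rw [div_le_iff₀ hε] at hqε
      rw [div_le_div_iff₀ hq1 (by positivity)]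
      linarith
    have h3 : (s i : ℝ) ≤ r i + 1 / q := by
      have := (Rat.cast_le (K := ℝ)).2 h1
      push_cast at this
      exact this
    linarith
  have hint : ∀ i, ∃ p : ℤ, q * s i = p := fun i => ⟨⌈q * r i⌉, by
    simp only [s]; field_simp⟩
  obtain ⟨N, hN0, hNq, hN⟩ := exists_divisible (E := E) hs hq hint
  have hNm := pow_bound hq hNq
  have htight : ∀ j, tightDims E N m j ≤ q ^ (m * 2 ^ (2 * m)) := by
    intro j
    refine le_trans ?_ hNm
    refine Nat.pow_le_pow_left ?_ m
    rw [factorDims]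
    split_ifs <;> omega
  have hcov : ∀ j, tightDims E N m j = 1 ∨ ∃ i, j ∈ nbr E i := by
    intro j
    by_cases hj : ∃ i, j ∈ nbr E i
    · exact Or.inr hj
    · left
      rw [tightDims, factorDims, if_neg hj, one_pow]
  -- The bound on `D` is chosen for this: leftover fractions of at most `ε/(2mn)` per qudit sum up
  -- to the other half.
  have hdδ : ∀ j, (n : ℝ) * tightDims E N m j ≤ ε / (2 * m) * d j := by
    intro j
    have h1 := Nat.ceil_le.1 (hdD j)
    have h2 : (tightDims E N m j : ℝ) ≤ (q : ℝ) ^ (m * 2 ^ (2 * m)) := by exact_mod_cast htight j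
    rw [div_le_iff₀ hε] at h1
    rw [div_mul_eq_mul_div, le_div_iff₀ (by positivity)]
    have h3 : (n : ℝ) * tightDims E N m j * (2 * m) ≤ n * (q : ℝ) ^ (m * 2 ^ (2 * m)) * (2 * m) := by
      gcongr
    linarith
  have hcore : ∃ W₀ : (i : Fin m) → Submodule ℂ (QuditSpace (restrictDims (tightDims E N m)
      (nbr E i))), (∀ i, relDim (W₀ i) ≤ s i) ∧
      (BeyondShearer (depGraph E) r →
        1 ≤ relDim (⨆ i, extend (nbr E i) (W₀ i) : Submodule ℂ (QuditSpace (tightDims E N m)))) ∧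
      (¬ BeyondShearer (depGraph E) r → 1 - indepPoly (depGraph E) r ≤
        relDim (⨆ i, extend (nbr E i) (W₀ i) : Submodule ℂ (QuditSpace (tightDims E N m)))) := by
    have hnon : Nonempty (Config (tightDims E N m)) :=
      nonempty_config fun j => tightDims_pos hN0 m j
    -- Rounding up may leave Shearer's bound but cannot enter it, and it only lowers `I` inside. If
    -- `s` is beyond the bound, the whole space is filled, which suffices in either case for `r`.
    by_cases hS : InShearer (depGraph E) s Finset.univ
    · obtain ⟨W, hW, -, hW'⟩ := exists_relDim_iSup_ge hN0 hN hne (k := m) Finset.univ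
        (by simp) hS
      refine ⟨W, fun i => (hW i (Finset.mem_univ i)).le, fun hb => ?_, fun _ => ?_⟩
      · exact absurd hb ((not_beyondShearer_iff _ _).2 (hS.anti hr hrs))
      · refine le_trans ?_ hW'
        rw [← indepSum_univ]
        have := indepSum_anti hr hrs hS
        linarith
    · obtain ⟨W, hW, hW'⟩ := exists_iSup_eq_top hs hN0 hN hne hS
      refine ⟨W, hW, fun _ => ?_, fun hb => ?_⟩
      · rw [hW', relDim_top]
      · rw [hW', relDim_top, ← indepSum_univ]
        have := (not_beyondShearer_iff _ _).1 hb _ subset_rfl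
        linarith
  obtain ⟨W₀, hW₀, hW₁, hW₂⟩ := hcore
  obtain ⟨W, hW, hW'⟩ := exists_subspaces_of_le (tightDims_pos hN0 m) hd hcov
    (δ := ε / (2 * m)) (by positivity) hdδ W₀
  refine ⟨W, fun i => ?_, fun hb => ?_, fun hb => (hW₂ hb).trans hW'⟩
  · have h1 : (relDim (W₀ i) : ℝ) ≤ s i := by exact_mod_cast hW₀ i
    have h2 := hsr i
    have h3 := hW i
    have h4 : ε / (2 * m) + ε / (2 * m) = ε / m := by field_simp; ring
    linarith
  · exact le_antisymm (relDim_le_one _) ((hW₁ hb).trans hW')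

end Approximation

/-! ### Almost sure statements -/

section AlmostAll

variable {m n : ℕ} {E : Finset (Fin m × Fin n)} {d : Fin n → ℕ}

theorem almostAll_mono {r : Fin m → ℚ} {P P' : (Fin m → Submodule ℂ (QuditSpace d)) → Prop}
    (h : AlmostAll E r d P) (hP : ∀ V, P V → P' V) : AlmostAll E r d P' := fun W hW =>
  (h W hW).mono fun _ hU => hP _ hU

/-- The local space of no qudits is one-dimensional, so a nonzero subspace of it is everything. -/
theorem almostAll_relDim_eq_one_of_nbr_eq_empty {r : Fin m → ℚ} (hd : ∀ j, 0 < d j) {i : Fin m}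
    (hi : nbr E i = ∅) (hr : 0 < r i) :
    AlmostAll E r d fun V => relDim (⨆ i, V i) = 1 := by
  intro W hW
  refine Filter.Eventually.of_forall fun U => ?_
  have hnon : Nonempty (Config d) := nonempty_config hd
  have hcard : Fintype.card (Config (restrictDims d (nbr E i))) = 1 := by
    rw [card_config_restrict, hi, Finset.prod_empty]
  have h1 : Module.finrank ℂ (W i) ≠ 0 := by
    intro h
    have := hW i
    rw [relDim_eq, h] at this
    simp at this
    linarith
  have h2 : rotate (U i) (W i) = ⊤ := by
    apply Submodule.eq_top_of_finrank_eq
    refine (Submodule.finrank_le _).antisymm ?_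
    rw [finrank_rotate, Module.finrank_fintype_fun_eq_card, hcard]
    exact Nat.pos_of_ne_zero h1
  have h3 : (⨆ i, extend (nbr E i) (rotate (U i) (W i)) : Submodule ℂ (QuditSpace d)) = ⊤ := by
    rw [eq_top_iff]
    refine le_trans ?_ (le_iSup _ i)
    rw [h2, extend_top]
  change relDim (⨆ i, extend (nbr E i) (rotate (U i) (W i)) : Submodule ℂ (QuditSpace d)) = 1
  rw [h3, relDim_top]

theorem almostAll_relDim_le (hd : ∀ j, 0 < d j) {r : Fin m → ℚ} (hr : ∀ i, 0 ≤ r i)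
    (hS : ¬ BeyondShearer (depGraph E) r) :
    AlmostAll E r d fun V => relDim (⨆ i, V i) ≤ 1 - indepPoly (depGraph E) r := fun W hW =>
  Filter.Eventually.of_forall fun U => relDim_iSup_le hd hr _
    (fun i => (relDim_congr (finrank_rotate (U i) (W i))).trans (hW i))
    ((not_beyondShearer_iff _ _).1 hS)

theorem almostAll_relDim_ge_of_le
    (W : (i : Fin m) → Submodule ℂ (QuditSpace (restrictDims d (nbr E i)))) (hd : ∀ j, 0 < d j)
    {r : Fin m → ℚ} (hr : ∀ i, relDim (W i) ≤ r i) :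
    AlmostAll E r d fun V =>
      relDim (⨆ i, extend (nbr E i) (W i) : Submodule ℂ (QuditSpace d)) ≤ relDim (⨆ i, V i) := by
  intro W' hW'
  have h : ∀ i, Module.finrank ℂ (W i) ≤ Module.finrank ℂ (W' i) := by
    intro i
    have h1 := hr i
    have hc : (0 : ℚ) < Fintype.card (Config (restrictDims d (nbr E i))) := by
      have := nonempty_config (d := restrictDims d (nbr E i)) fun j => hd j
      exact_mod_cast Fintype.card_pos
    rw [← hW' i, relDim_eq, relDim_eq, div_le_div_iff_of_pos_right hc] at h1
    exact_mod_cast h1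
  exact (ae_finrank_iSup_extend_le (nbr E) d W' W h).mono fun U hU => relDim_le_of_finrank_le hU

theorem relDim_sup_le {A : Type*} [Fintype A] (X Y : Submodule ℂ (A → ℂ)) :
    relDim (X ⊔ Y) ≤ relDim X + relDim Y := by
  rw [relDim, relDim, relDim, ← add_div]
  have := Submodule.finrank_add_le_finrank_add_finrank X Y
  gcongr
  exact_mod_cast this

theorem relDim_iSup_le_sum {A ι : Type*} [Fintype A] [Fintype ι] (X : ι → Submodule ℂ (A → ℂ)) :
    relDim (⨆ i, X i) ≤ ∑ i, relDim (X i) := by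
  classical
  have h : ∀ S : Finset ι, relDim (⨆ i ∈ S, X i) ≤ ∑ i ∈ S, relDim (X i) := by
    intro S
    induction S using Finset.induction_on with
    | empty => simp [relDim_bot]
    | insert i S hi ih =>
      rw [Finset.iSup_insert, Finset.sum_insert hi]
      exact (relDim_sup_le _ _).trans (by linarith)
  simpa using h Finset.univ

/-- Each `W i` is covered by a subspace `V` of the prescribed dimension and a remainder `C` of
relative dimension at most `ε/m`. The `m` remainders contribute at most `ε` to the sum, and the
subspaces `V` are an example for the generic bound. -/
theorem almostAll_relDim_ge_sub (hm : 0 < m)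
    (W : (i : Fin m) → Submodule ℂ (QuditSpace (restrictDims d (nbr E i)))) (hd : ∀ j, 0 < d j)
    {r : Fin m → ℚ} {ε : ℝ} (hε : 0 < ε) (hr : ∀ i, (relDim (W i) : ℝ) ≤ r i + ε / m) :
    AlmostAll E r d fun V =>
      (relDim (⨆ i, extend (nbr E i) (W i) : Submodule ℂ (QuditSpace d)) : ℝ) - ε ≤
        relDim (⨆ i, V i) := by
  intro W' hW'
  have hm0 : (0 : ℝ) < m := by exact_mod_cast hm
  have hex : ∀ i, ∃ V C : Submodule ℂ (QuditSpace (restrictDims d (nbr E i))),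
      Module.finrank ℂ V = Module.finrank ℂ (W' i) ∧ W i ≤ V ⊔ C ∧ (relDim C : ℝ) ≤ ε / m := by
    intro i
    rcases le_total (Module.finrank ℂ (W i)) (Module.finrank ℂ (W' i)) with h | h
    · obtain ⟨V, hV, hf⟩ := exists_ge_finrank_eq (W i) h (Submodule.finrank_le _)
      refine ⟨V, ⊥, hf, by simpa using hV, ?_⟩
      rw [relDim_bot, Rat.cast_zero]
      positivity
    · have : Nonempty (Config (restrictDims d (nbr E i))) := nonempty_config fun j => hd j
      obtain ⟨V, C, hVC, hV, hC⟩ := exists_le_relDim_eq (W i) (relDim_le_of_finrank_le h)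
        ⟨Module.finrank ℂ (W' i), by
          rw [relDim_eq, div_mul_cancel₀]
          exact_mod_cast Fintype.card_ne_zero⟩
      refine ⟨V, C, finrank_eq_of_relDim_eq hV, hVC.ge, ?_⟩
      rw [hC, hW' i]
      push_cast
      linarith [hr i]
  choose V C hV hVC hC using hex
  have h1 : (⨆ i, extend (nbr E i) (W i) : Submodule ℂ (QuditSpace d)) ≤
      (⨆ i, extend (nbr E i) (V i)) ⊔ ⨆ i, extend (nbr E i) (C i) := by
    rw [← iSup_sup_eq]
    refine iSup_mono fun i => ?_
    rw [← extend_sup]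
    exact extend_mono (hVC i)
  have h2 := (relDim_mono h1).trans ((relDim_sup_le _ _).trans
    (add_le_add_right (relDim_iSup_le_sum _) _))
  have h3 : ((∑ i, relDim (extend (nbr E i) (C i)) : ℚ) : ℝ) ≤ ε := by
    push_cast
    calc _ ≤ ∑ _i : Fin m, ε / m := Finset.sum_le_sum fun i _ => by
          rw [relDim_extend hd]; exact hC i
      _ = ε := by
          rw [Finset.sum_const, Finset.card_univ, Fintype.card_fin, nsmul_eq_mul]
          field_simp
  have h4 := almostAll_relDim_ge_of_le V hd (r := r)
    (fun i => ((relDim_congr (hV i)).trans (hW' i)).le) W' hW'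
  refine h4.mono fun U hU => ?_
  have h5 : ((relDim (⨆ i, extend (nbr E i) (W i) : Submodule ℂ (QuditSpace d)) : ℚ) : ℝ) ≤
      relDim (⨆ i, extend (nbr E i) (V i) : Submodule ℂ (QuditSpace d)) +
        ((∑ i, relDim (extend (nbr E i) (C i) : Submodule ℂ (QuditSpace d)) : ℚ) : ℝ) := by
    exact_mod_cast h2
  have h6 : ((relDim (⨆ i, extend (nbr E i) (V i) : Submodule ℂ (QuditSpace d)) : ℚ) : ℝ) ≤
      relDim (⨆ i, extend (nbr E i) (rotate (U i) (W' i)) : Submodule ℂ (QuditSpace d)) := by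
    exact_mod_cast hU
  linarith

end AlmostAll

end QLLL

/-! ### The theorem -/

theorem theorem1 (m n : ℕ) (E : Finset (Fin m × Fin n)) (ε : ℝ) (hε : 0 < ε) :
    ∃ D : Fin n → ℕ,
      (∀ j, D j ≤ ⌈2 * (⌈2 * (m : ℝ) / ε⌉₊ : ℝ) ^ (m * 2 ^ (2 * m)) * (m : ℝ) * (n : ℝ) / ε⌉₊) ∧
      ∀ d : Fin n → ℕ, (∀ j, 0 < d j) → (∀ j, D j ≤ d j) →
      ∀ r : Fin m → ℚ, (∀ i, 0 < r i ∧ r i ≤ 1) →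
        (QLLL.BeyondShearer (QLLL.depGraph E) r →
          (∀ r' : Fin m → ℚ, (∀ i, (r i : ℝ) + ε / (m : ℝ) ≤ (r' i : ℝ)) →
            QLLL.AlmostAll E r' d fun V => QLLL.relDim (⨆ i, V i) = 1) ∧
          QLLL.AlmostAll E r d fun V =>
            ((QLLL.relDim (⨆ i, V i) : ℚ) : ℝ) ∈ Set.Icc (1 - ε) 1) ∧
        (¬ QLLL.BeyondShearer (QLLL.depGraph E) r →
          (∀ r' : Fin m → ℚ, (∀ i, (r i : ℝ) + ε / (m : ℝ) ≤ (r' i : ℝ)) →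
            QLLL.AlmostAll E r' d fun V =>
              1 - QLLL.indepPoly (QLLL.depGraph E) r ≤ QLLL.relDim (⨆ i, V i)) ∧
          QLLL.AlmostAll E r d fun V =>
            ((QLLL.relDim (⨆ i, V i) : ℚ) : ℝ) ∈
              Set.Icc (1 - (QLLL.indepPoly (QLLL.depGraph E) r : ℝ) - ε)
                (1 - (QLLL.indepPoly (QLLL.depGraph E) r : ℝ))) := by
  classical
  refine ⟨fun _ => _, fun _ => le_rfl, ?_⟩
  intro d hd hdD r hr
  have hr0 : ∀ i, 0 ≤ r i := fun i => (hr i).1.le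
  have hle_one : ∀ V : Fin m → Submodule ℂ (QLLL.QuditSpace d),
      ((QLLL.relDim (⨆ i, V i) : ℚ) : ℝ) ≤ 1 := fun V => by
    exact_mod_cast QLLL.relDim_le_one (⨆ i, V i)
  -- Without left vertices the sum is zero and `I = 1`; this case is separate since the other
  -- arguments divide by `m`.
  rcases Nat.eq_zero_or_pos m with rfl | hm
  · have hI : QLLL.indepPoly (QLLL.depGraph E) r = 1 := by
      rw [← QLLL.indepSum_univ, Finset.univ_eq_empty, QLLL.indepSum_empty]
    have hb : ¬ QLLL.BeyondShearer (QLLL.depGraph E) r := by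
      rw [QLLL.not_beyondShearer_iff]
      intro T _
      rw [Finset.eq_empty_of_isEmpty T, QLLL.indepSum_empty]
      exact one_pos
    refine ⟨fun h => absurd h hb, fun _ => ⟨fun r' _ W _ => Filter.Eventually.of_forall fun U => ?_,
      fun W _ => Filter.Eventually.of_forall fun U => ?_⟩⟩
    · rw [hI, sub_self]
      exact QLLL.relDim_nonneg _
    · have hbot : ∀ V : Fin 0 → Submodule ℂ (QLLL.QuditSpace d), QLLL.relDim (⨆ i, V i) = 0 :=
        fun V => by rw [iSup_of_empty, QLLL.relDim_bot]
      simp only [hI, hbot]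
      constructor <;> push_cast <;> linarith
  have hm0 : (0 : ℝ) < m := by exact_mod_cast hm
  have hpos : ∀ r' : Fin m → ℚ, (∀ i, (r i : ℝ) + ε / (m : ℝ) ≤ (r' i : ℝ)) → ∀ i, 0 < r' i := by
    intro r' hr' i
    have h1 : (0 : ℝ) < r i := by exact_mod_cast (hr i).1
    have h2 : (0 : ℝ) < r' i := by
      have := div_pos hε hm0
      linarith [hr' i]
    exact_mod_cast h2
  have hIpos : ¬ QLLL.BeyondShearer (QLLL.depGraph E) r →
      0 < QLLL.indepPoly (QLLL.depGraph E) r := fun hb => by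
    rw [← QLLL.indepSum_univ]
    exact (QLLL.not_beyondShearer_iff _ _).1 hb _ subset_rfl
  -- The upper bounds are `1`, or Shearer's bound for subspaces, so only lower bounds remain.
  suffices hlow : (QLLL.BeyondShearer (QLLL.depGraph E) r →
      (∀ r' : Fin m → ℚ, (∀ i, (r i : ℝ) + ε / (m : ℝ) ≤ (r' i : ℝ)) →
        QLLL.AlmostAll E r' d fun V => QLLL.relDim (⨆ i, V i) = 1) ∧
      QLLL.AlmostAll E r d fun V => 1 - ε ≤ ((QLLL.relDim (⨆ i, V i) : ℚ) : ℝ)) ∧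
      (¬ QLLL.BeyondShearer (QLLL.depGraph E) r →
      (∀ r' : Fin m → ℚ, (∀ i, (r i : ℝ) + ε / (m : ℝ) ≤ (r' i : ℝ)) →
        QLLL.AlmostAll E r' d fun V =>
          1 - QLLL.indepPoly (QLLL.depGraph E) r ≤ QLLL.relDim (⨆ i, V i)) ∧
      QLLL.AlmostAll E r d fun V => 1 - (QLLL.indepPoly (QLLL.depGraph E) r : ℝ) - ε ≤
        ((QLLL.relDim (⨆ i, V i) : ℚ) : ℝ)) by
    refine ⟨fun hb => ⟨(hlow.1 hb).1, QLLL.almostAll_mono (hlow.1 hb).2 fun V hV =>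
      ⟨hV, hle_one V⟩⟩, fun hb => ⟨(hlow.2 hb).1, fun W hW => ?_⟩⟩
    filter_upwards [(hlow.2 hb).2 W hW, QLLL.almostAll_relDim_le hd hr0 hb W hW] with U h1 h2
    refine ⟨h1, ?_⟩
    have := (Rat.cast_le (K := ℝ)).2 h2
    push_cast at this
    exact this
  -- The extremal construction realises the dimensions `r i` by enlarging qudits in `N(i)`, so it
  -- needs nonempty neighbourhoods. A vertex with no neighbours fills the space by itself.
  by_cases hne : ∀ i, (QLLL.nbr E i).Nonempty
  · obtain ⟨W, hW, hWb, hWn⟩ := QLLL.exists_almost_tight hm hne hε hd hdD hr0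
    have hW' : ∀ r' : Fin m → ℚ, (∀ i, (r i : ℝ) + ε / (m : ℝ) ≤ (r' i : ℝ)) →
        ∀ i, QLLL.relDim (W i) ≤ r' i := by
      intro r' hr' i
      exact_mod_cast (hW i).trans (hr' i)
    refine ⟨fun hb => ⟨fun r' hr' => ?_, ?_⟩, fun hb => ⟨fun r' hr' => ?_, ?_⟩⟩
    · refine QLLL.almostAll_mono (QLLL.almostAll_relDim_ge_of_le W hd (hW' r' hr')) fun V hV => ?_
      rw [hWb hb] at hV
      exact le_antisymm (QLLL.relDim_le_one _) hV
    · refine QLLL.almostAll_mono (QLLL.almostAll_relDim_ge_sub hm W hd hε hW) fun V hV => ?_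
      rw [hWb hb, Rat.cast_one] at hV
      exact hV
    · exact QLLL.almostAll_mono (QLLL.almostAll_relDim_ge_of_le W hd (hW' r' hr')) fun V hV =>
        (hWn hb).trans hV
    · refine QLLL.almostAll_mono (QLLL.almostAll_relDim_ge_sub hm W hd hε hW) fun V hV => ?_
      have := (Rat.cast_le (K := ℝ)).2 (hWn hb)
      push_cast at this
      linarith
  · push Not at hne
    obtain ⟨i, hi⟩ := hne
    refine ⟨fun hb => ⟨fun r' hr' => ?_, ?_⟩, fun hb => ⟨fun r' hr' => ?_, ?_⟩⟩
    · exact QLLL.almostAll_relDim_eq_one_of_nbr_eq_empty hd hi (hpos r' hr' i)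
    · refine QLLL.almostAll_mono
        (QLLL.almostAll_relDim_eq_one_of_nbr_eq_empty hd hi (hr i).1) fun V hV => ?_
      rw [hV, Rat.cast_one]
      linarith
    · refine QLLL.almostAll_mono
        (QLLL.almostAll_relDim_eq_one_of_nbr_eq_empty hd hi (hpos r' hr' i)) fun V hV => ?_
      rw [hV]
      linarith [hIpos hb]
    · refine QLLL.almostAll_mono
        (QLLL.almostAll_relDim_eq_one_of_nbr_eq_empty hd hi (hr i).1) fun V hV => ?_
      have : (0 : ℝ) < QLLL.indepPoly (QLLL.depGraph E) r := by exact_mod_cast hIpos hb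
      rw [hV, Rat.cast_one]
      linarith
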